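/- Notation. For $k,k_1,k_2\ge 1$ and $d,d_1,d_2\ge 0$ define in $\mathbb{Q}[[q]]$ $$g\binom{k}{d}=\sum_{m,n>0}\frac{m^{d}n^{k-1}}{(k-1)!}q^{mn},\qquad g\binom{k_1,k_2}{d_1,d_2}=\sum_{\substack{m_1>m_2>0\\ n_1,n_2>0}}\frac{m_1^{d_1}n_1^{k_1-1}}{(k_1-1)!}\frac{m_2^{d_2}n_2^{k_2-1}}{(k_2-1)!}\,q^{m_1n_1+m_2n_2},$$ with generating series $$\mathfrak{g}_1\binom{X}{Y}=\sum_{k\ge1,\,d\ge0} g\binom{k}{d}X^{k-1}\frac{Y^d}{d!},\qquad \mathfrak{g}_2\binom{X_1,X_2}{Y_1,Y_2}=\sum_{k_1,k_2\ge1,\;d_1,d_2\ge0}g\binom{k_1,k_2}{d_1,d_2}X_1^{k_1-1}X_2^{k_2-1}\frac{Y_1^{d_1}}{d_1!}\frac{Y_2^{d_2}}{d_2!}.$$ Let $\mathfrak{b}_1\binom{X}{Y}=-\frac14\left(\coth\frac X2+\coth\frac Y2\right)+\frac12\left(\frac1X+\frac1Y\right)\in\mathbb{Q}[[X,Y]]$.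 For a power series $f\binom{X}{Y}$ put $$R^\ast_f\binom{X_1,X_2}{Y_1,Y_2}=\frac{f\binom{X_1}{Y_1+Y_2}-f\binom{X_2}{Y_1+Y_2}}{X_1-X_2},\qquad R^{\sqcup\!\sqcup}_f\binom{X_1,X_2}{Y_1,Y_2}=\frac{f\binom{X_1+X_2}{Y_1}-f\binom{X_1+X_2}{Y_2}}{Y_1-Y_2},$$ which are again power series, and let $\mathfrak{P}_{\mathfrak b}\binom{X_1,X_2}{Y_1,Y_2}=\mathfrak{b}_1\binom{X_1}{Y_1}\mathfrak{b}_1\binom{X_2}{Y_2}$ and $$\begin{aligned}\mathfrak{b}_2\binom{X_1,X_2}{Y_1,Y_2}={}&\tfrac13\mathfrak{P}_{\mathfrak b}\binom{X_1,X_2}{Y_1,Y_2}+\tfrac13\mathfrak{P}_{\mathfrak b}\binom{X_1-X_2,X_2}{Y_1,Y_1+Y_2}\\&-\tfrac5{12}R^{\sqcup\!\sqcup}_{\mathfrak b_1}\binom{X_1-X_2,X_2}{Y_1,Y_1+Y_2}-\tfrac1{12}R^{\sqcup\!\sqcup}_{\mathfrak b_1}\binom{-X_2,X_1}{-Y_2,Y_1}+\tfrac14R^{\sqcup\!\sqcup}_{\mathfrak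 b_1}\binom{X_2-X_1,X_1}{Y_2,Y_1+Y_2}\\&-\tfrac5{12}R^{\ast}_{\mathfrak b_1}\binom{X_1,X_2}{Y_1,Y_2}-\tfrac1{12}R^{\ast}_{\mathfrak b_1}\binom{X_2-X_1,X_2}{-Y_1,Y_1+Y_2}+\tfrac14R^{\ast}_{\mathfrak b_1}\binom{X_1-X_2,X_1}{-Y_2,Y_1+Y_2}.\end{aligned}$$ For $K\ge1$, the formal double Eisenstein space $\mathcal{E}_K$ of weight $K$ is the $\mathbb{Q}$-vector space spanned by formal symbols $G\binom{k}{d}$, $G\binom{k_1,k_2}{d_1,d_2}$, $P\binom{k_1,k_2}{d_1,d_2}$ with $k+d=k_1+k_2+d_1+d_2=K$, $k,k_1,k_2\ge1$, $d,d_1,d_2\ge0$, modulo the relations $$\begin{aligned}P\binom{k_1,k_2}{d_1,d_2}&=G\binom{k_1,k_2}{d_1,d_2}+G\binom{k_2,k_1}{d_2,d_1}+G\binom{k_1+k_2}{d_1+d_2}\\&=\sum_{\substack{l_1+l_2=k_1+k_2,\ l_1,l_2\ge1\\e_1+e_2=d_1+d_2,\ e_1,e_2\ge0}}\left(\binom{l_1-1}{k_1-1}\binom{d_1}{e_1}(-1)^{d_1-e_1}+\binom{l_1-1}{k_2-1}\binom{d_2}{e_1}(-1)^{d_2-e_1}\right)G\binom{l_1,l_2}{e_1,e_2}\\&\quad+\frac{d_1!\,d_2!}{(d_1+d_2+1)!}\binom{k_1+k_2-2}{k_1-1}G\binom{k_1+k_2-1}{d_1+d_2+1}\end{aligned}$$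 (a binomial coefficient $\binom{n}{r}$ with $r>n$ is $0$). Finally let $\widetilde G_1=g\binom10$ and $\widetilde G_k=-\frac{B_k}{2\,k!}+\frac1{(k-1)!}\sum_{n>0}\sigma_{k-1}(n)q^n$ for $k\ge2$. Theorem. The power series $$\mathfrak{E}_1\binom{X_1}{Y_1}=\mathfrak{b}_1\binom{X_1}{Y_1}+\mathfrak{g}_1\binom{X_1}{Y_1},$$ $$\begin{aligned}\mathfrak{E}_2\binom{X_1,X_2}{Y_1,Y_2}={}&\mathfrak{b}_2\binom{X_1,X_2}{Y_1,Y_2}-\mathfrak{b}_1\binom{X_1-X_2}{Y_2}\mathfrak{g}_1\binom{X_1}{Y_1+Y_2}-\tfrac12\mathfrak{g}_1\binom{X_1}{Y_1+Y_2}\\&+\mathfrak{b}_1\binom{X_2}{Y_2}\mathfrak{g}_1\binom{X_1}{Y_1}+\mathfrak{b}_1\binom{X_1-X_2}{Y_1}\mathfrak{g}_1\binom{X_2}{Y_1+Y_2}+\mathfrak{g}_2\binom{X_1,X_2}{Y_1,Y_2}\end{aligned}$$ and $\mathfrak{P}_{\mathfrak E}\binom{X_1,X_2}{Y_1,Y_2}=\mathfrak{E}_1\binom{X_1}{Y_1}\mathfrak{E}_1\binom{X_2}{Y_2}$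 satisfy $$\begin{aligned}\mathfrak{P}_{\mathfrak E}\binom{X_1,X_2}{Y_1,Y_2}&=\mathfrak{E}_2\binom{X_1,X_2}{Y_1,Y_2}+\mathfrak{E}_2\binom{X_2,X_1}{Y_2,Y_1}+\frac{\mathfrak{E}_1\binom{X_1}{Y_1+Y_2}-\mathfrak{E}_1\binom{X_2}{Y_1+Y_2}}{X_1-X_2}\\&=\mathfrak{E}_2\binom{X_1+X_2,X_2}{Y_1,Y_2-Y_1}+\mathfrak{E}_2\binom{X_1+X_2,X_1}{Y_2,Y_1-Y_2}+\frac{\mathfrak{E}_1\binom{X_1+X_2}{Y_1}-\mathfrak{E}_1\binom{X_1+X_2}{Y_2}}{Y_1-Y_2}.\end{aligned}$$ Consequently, for every $K\ge1$ there is a unique $\mathbb{Q}$-linear map $\mathcal{E}_K\to\mathbb{Q}[[q]]$ that sends $G\binom{k}{d}$ to the coefficient of $X_1^{k-1}\frac{Y_1^d}{d!}$ in $\mathfrak{E}_1$, and $G\binom{k_1,k_2}{d_1,d_2}$ and $P\binom{k_1,k_2}{d_1,d_2}$ to the coefficients of $X_1^{k_1-1}X_2^{k_2-1}\frac{Y_1^{d_1}}{d_1!}\frac{Y_2^{d_2}}{d_2!}$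 in $\mathfrak{E}_2$ and $\mathfrak{P}_{\mathfrak E}$, respectively (the Eisenstein realization). It satisfies $$G\binom{k}{d}\longmapsto\frac{(k-d-1)!}{(k-1)!}\left(q\frac{d}{dq}\right)^{d}\widetilde G_{k-d}\quad(k>d\ge0,\ k+d=K),\qquad P\binom{k_1,k_2}{0,0}\longmapsto\widetilde G_{k_1}\widetilde G_{k_2}\quad(k_1,k_2\ge1,\ k_1+k_2=K).$$ -/

import Mathlib

open scoped Nat

noncomputable section

namespace DoubleEisenstein

/-! ### Formal power series in two and four variables -/

/-- The exponent of the monomial `X^a Y^b`. -/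
def expo2 (a b : ℕ) : Fin 2 →₀ ℕ := Finsupp.equivFunOnFinite.symm ![a, b]

/-- The exponent of the monomial `X₁^a X₂^b Y₁^c Y₂^d`. -/
def expo4 (a b c d : ℕ) : Fin 4 →₀ ℕ := Finsupp.equivFunOnFinite.symm ![a, b, c, d]

/-- The variable `X₁`. -/
abbrev X₁ {R : Type} [CommRing R] : MvPowerSeries (Fin 4) R := MvPowerSeries.X 0

/-- The variable `X₂`. -/
abbrev X₂ {R : Type} [CommRing R] : MvPowerSeries (Fin 4) R := MvPowerSeries.X 1

/-- The variable `Y₁`. -/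
abbrev Y₁ {R : Type} [CommRing R] : MvPowerSeries (Fin 4) R := MvPowerSeries.X 2

/-- The variable `Y₂`. -/
abbrev Y₂ {R : Type} [CommRing R] : MvPowerSeries (Fin 4) R := MvPowerSeries.X 3

/-- Substitution `f(x; y)` of power series in `X₁, X₂, Y₁, Y₂` without constant term. -/
def ev2 {R : Type} [CommRing R] (f : MvPowerSeries (Fin 2) R) (x y : MvPowerSeries (Fin 4) R) :
    MvPowerSeries (Fin 4) R :=
  f.subst ![x, y]

/-- Substitution `f(x₁, x₂; y₁, y₂)` of power series in `X₁, X₂, Y₁, Y₂` without constant term. -/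
def ev4 {R : Type} [CommRing R] (f : MvPowerSeries (Fin 4) R)
    (x₁ x₂ y₁ y₂ : MvPowerSeries (Fin 4) R) : MvPowerSeries (Fin 4) R :=
  f.subst ![x₁, x₂, y₁, y₂]

/-- For `f(X; Y)`, the power series `(f(U; W) - f(V; W)) / (U - V)` in the variables `U, V, W`;
see `sub_mul_divDiff`. -/
def divDiff {R : Type} [CommRing R] (f : MvPowerSeries (Fin 2) R) : MvPowerSeries (Fin 3) R :=
  fun e => f.coeff (expo2 (e 0 + e 1 + 1) (e 2))

/-- The power series `f(Y; X)`. -/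
def flipXY {R : Type} [CommRing R] (f : MvPowerSeries (Fin 2) R) : MvPowerSeries (Fin 2) R :=
  fun e => f.coeff (expo2 (e 1) (e 0))

/-- The power series `(f(X₁; Y₁ + Y₂) - f(X₂; Y₁ + Y₂)) / (X₁ - X₂)`; see `sub_mul_stuffleQuot`. -/
def stuffleQuot {R : Type} [CommRing R] (f : MvPowerSeries (Fin 2) R) : MvPowerSeries (Fin 4) R :=
  (divDiff f).subst ![X₁, X₂, Y₁ + Y₂]

/-- The power series `(f(X₁ + X₂; Y₁) - f(X₁ + X₂; Y₂)) / (Y₁ - Y₂)`; see `sub_mul_shuffleQuot`. -/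
def shuffleQuot {R : Type} [CommRing R] (f : MvPowerSeries (Fin 2) R) : MvPowerSeries (Fin 4) R :=
  (divDiff (flipXY f)).subst ![Y₁, Y₂, X₁ + X₂]

theorem subst_pair_coeff {R : Type} [CommRing R] (f : MvPowerSeries (Fin 2) R)
    {n : ℕ} (i j : Fin n) (hij : i ≠ j) (e : Fin n →₀ ℕ) :
    (f.subst ![(MvPowerSeries.X i : MvPowerSeries (Fin n) R), MvPowerSeries.X j]).coeff e
      = if ∀ k, k ≠ i → k ≠ j → e k = 0 then f.coeff (expo2 (e i) (e j)) else 0 := by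
  classical
  let em : Fin 2 ↪ Fin n := ⟨![i, j], by
    intro a b
    fin_cases a <;> fin_cases b <;> simp [hij, hij.symm]⟩
  have hcomp : (![(MvPowerSeries.X i : MvPowerSeries (Fin n) R), MvPowerSeries.X j])
      = MvPowerSeries.X ∘ em := by
    funext a
    fin_cases a <;> rfl
  rw [hcomp, ← MvPowerSeries.rename_eq_subst]
  split_ifs with h
  · have he : e = Finsupp.embDomain em (expo2 (e i) (e j)) := by
      ext k
      by_cases hk : k ∈ Set.range em
      · obtain ⟨a, rfl⟩ := hk
        rw [Finsupp.embDomain_apply_self]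
        fin_cases a
        · change e i = _
          simp [expo2]
        · change e j = _
          simp [expo2]
      · rw [Finsupp.embDomain_of_notMem_range _ _ _ hk]
        apply h
        · rintro rfl
          exact hk ⟨0, rfl⟩
        · rintro rfl
          exact hk ⟨1, rfl⟩
    conv_lhs => rw [he]
    rw [MvPowerSeries.coeff_embDomain_rename]
  · apply MvPowerSeries.coeff_rename_eq_zero
    rintro ⟨x, rfl⟩
    apply h
    intro k hki hkj
    apply Finsupp.mapDomain_of_notMem_range
    rintro ⟨a, rfl⟩
    fin_cases a
    · exact hki rfl
    · exact hkj rfl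

theorem coeff_X_mul_ite {R : Type} [CommRing R] {n : ℕ} (i : Fin n)
    (f : MvPowerSeries (Fin n) R) (e : Fin n →₀ ℕ) :
    (MvPowerSeries.X i * f).coeff e
      = if 1 ≤ e i then f.coeff (e - Finsupp.single i 1) else 0 := by
  classical
  rw [MvPowerSeries.X, MvPowerSeries.coeff_monomial_mul]
  simp

/-- `divDiff f` is the quotient `(f(U; W) - f(V; W)) / (U - V)`. -/
theorem sub_mul_divDiff {R : Type} [CommRing R] (f : MvPowerSeries (Fin 2) R) :
    (MvPowerSeries.X 0 - MvPowerSeries.X 1) * divDiff f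
      = f.subst ![(MvPowerSeries.X 0 : MvPowerSeries (Fin 3) R), MvPowerSeries.X 2]
        - f.subst ![(MvPowerSeries.X 1 : MvPowerSeries (Fin 3) R), MvPowerSeries.X 2] := by
  ext e
  rw [sub_mul, map_sub, map_sub, coeff_X_mul_ite, coeff_X_mul_ite,
    subst_pair_coeff _ _ _ (by decide), subst_pair_coeff _ _ _ (by decide)]
  have h0 : (∀ k : Fin 3, k ≠ 0 → k ≠ 2 → e k = 0) ↔ e 1 = 0 := by
    constructor
    · intro h
      exact h 1 (by decide) (by decide)
    · intro h k
      fin_cases k <;> simp [h]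
  have h1 : (∀ k : Fin 3, k ≠ 1 → k ≠ 2 → e k = 0) ↔ e 0 = 0 := by
    constructor
    · intro h
      exact h 0 (by decide) (by decide)
    · intro h k
      fin_cases k <;> simp [h]
  simp only [h0, h1]
  have hd : ∀ m : Fin 3 →₀ ℕ, (divDiff f).coeff m = f.coeff (expo2 (m 0 + m 1 + 1) (m 2)) :=
    fun _ => rfl
  simp only [hd, Finsupp.coe_tsub, Pi.sub_apply]
  rcases Nat.eq_zero_or_pos (e 0) with ha | ha <;> rcases Nat.eq_zero_or_pos (e 1) with hb | hb
  · simp [ha, hb]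
  · have h2 : e 1 ≠ 0 := by omega
    have h3 : e 1 - 1 + 1 = e 1 := by omega
    simp [ha, h2, h3, Nat.one_le_iff_ne_zero]
  · have h2 : e 0 ≠ 0 := by omega
    have h3 : e 0 - 1 + 1 = e 0 := by omega
    simp [hb, h2, h3, Nat.one_le_iff_ne_zero]
  · have h2 : e 0 ≠ 0 := by omega
    have h3 : e 1 ≠ 0 := by omega
    have h4 : e 0 - 1 + e 1 + 1 = e 0 + (e 1 - 1) + 1 := by omega
    simp [h2, h3, h4, Nat.one_le_iff_ne_zero]

theorem hasSubst_vec {m n : ℕ} {R : Type} [CommRing R] (a : Fin m → MvPowerSeries (Fin n) R)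
    (h : ∀ i, (a i).constantCoeff = 0) : MvPowerSeries.HasSubst a :=
  MvPowerSeries.hasSubst_of_constantCoeff_zero h

theorem sub_mul_divDiff_subst {R : Type} [CommRing R] (f : MvPowerSeries (Fin 2) R)
    (u v w : MvPowerSeries (Fin 4) R) (hu : u.constantCoeff = 0) (hv : v.constantCoeff = 0)
    (hw : w.constantCoeff = 0) :
    (u - v) * (divDiff f).subst ![u, v, w] = ev2 f u w - ev2 f v w := by
  have ha : MvPowerSeries.HasSubst ![u, v, w] := hasSubst_vec _ (by
    intro i
    fin_cases i <;> simp [hu, hv, hw])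
  have h := congrArg (MvPowerSeries.subst ![u, v, w]) (sub_mul_divDiff f)
  have hX : ∀ i j : Fin 3, MvPowerSeries.HasSubst
      ![(MvPowerSeries.X i : MvPowerSeries (Fin 3) R), MvPowerSeries.X j] := by
    intro i j
    apply hasSubst_vec
    intro k
    fin_cases k <;> simp
  have key : ∀ i j : Fin 3, MvPowerSeries.subst ![u, v, w]
      (f.subst ![(MvPowerSeries.X i : MvPowerSeries (Fin 3) R), MvPowerSeries.X j])
      = ev2 f (![u, v, w] i) (![u, v, w] j) := by
    intro i j
    rw [MvPowerSeries.subst_comp_subst_apply (hX i j) ha, ev2]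
    congr 1
    funext k
    fin_cases k <;> simp [MvPowerSeries.subst_X ha]
  rw [MvPowerSeries.subst_mul ha, MvPowerSeries.subst_sub ha, MvPowerSeries.subst_sub ha,
    MvPowerSeries.subst_X ha, MvPowerSeries.subst_X ha, key, key] at h
  simpa using h

/-- `stuffleQuot f` is the quotient `(f(X₁; Y₁ + Y₂) - f(X₂; Y₁ + Y₂)) / (X₁ - X₂)`. -/
theorem sub_mul_stuffleQuot {R : Type} [CommRing R] (f : MvPowerSeries (Fin 2) R) :
    (X₁ - X₂) * stuffleQuot f = ev2 f X₁ (Y₁ + Y₂) - ev2 f X₂ (Y₁ + Y₂) :=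
  sub_mul_divDiff_subst f _ _ _ (by simp) (by simp) (by simp)

theorem ev2_flipXY {R : Type} [CommRing R] (f : MvPowerSeries (Fin 2) R)
    (x y : MvPowerSeries (Fin 4) R) (hx : x.constantCoeff = 0) (hy : y.constantCoeff = 0) :
    ev2 (flipXY f) x y = ev2 f y x := by
  have ha : MvPowerSeries.HasSubst ![x, y] := hasSubst_vec _ (by
    intro i
    fin_cases i <;> simp [hx, hy])
  have hX : MvPowerSeries.HasSubst
      ![(MvPowerSeries.X 1 : MvPowerSeries (Fin 2) R), MvPowerSeries.X 0] := by
    apply hasSubst_vec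
    intro k
    fin_cases k <;> simp
  have hf : flipXY f = f.subst
      ![(MvPowerSeries.X 1 : MvPowerSeries (Fin 2) R), MvPowerSeries.X 0] := by
    ext e
    rw [subst_pair_coeff _ _ _ (by decide), if_pos]
    · rfl
    · intro k
      fin_cases k <;> simp
  rw [hf, ev2, MvPowerSeries.subst_comp_subst_apply hX ha, ev2]
  congr 1
  funext k
  fin_cases k <;> simp [MvPowerSeries.subst_X ha]

/-- `shuffleQuot f` is the quotient `(f(X₁ + X₂; Y₁) - f(X₁ + X₂; Y₂)) / (Y₁ - Y₂)`. -/
theorem sub_mul_shuffleQuot {R : Type} [CommRing R] (f : MvPowerSeries (Fin 2) R) :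
    (Y₁ - Y₂) * shuffleQuot f = ev2 f (X₁ + X₂) Y₁ - ev2 f (X₁ + X₂) Y₂ := by
  rw [shuffleQuot, sub_mul_divDiff_subst _ _ _ _ (by simp) (by simp) (by simp),
    ev2_flipXY _ _ _ (by simp) (by simp), ev2_flipXY _ _ _ (by simp) (by simp)]

/-! ### The Bernoulli part -/

/-- The Laurent series of `coth (X / 2)`. -/
def cothHalf : LaurentSeries ℚ :=
  HahnSeries.ofPowerSeries ℤ ℚ
      (PowerSeries.rescale (1 / 2 : ℚ) (PowerSeries.exp ℚ)
        + PowerSeries.rescale (-1 / 2 : ℚ) (PowerSeries.exp ℚ)) /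
    HahnSeries.ofPowerSeries ℤ ℚ
      (PowerSeries.rescale (1 / 2 : ℚ) (PowerSeries.exp ℚ)
        - PowerSeries.rescale (-1 / 2 : ℚ) (PowerSeries.exp ℚ))

/-- The Laurent series `-(1/4) coth (X / 2) + 1 / (2 X)`. -/
def betaLaurent : LaurentSeries ℚ :=
  -(HahnSeries.C (1 / 4 : ℚ) * cothHalf)
    + HahnSeries.C (1 / 2 : ℚ) * (HahnSeries.ofPowerSeries ℤ ℚ PowerSeries.X)⁻¹

/-- The Laurent series `-(1/4) coth (X / 2) + 1 / (2 X)` as a power series; it has no principal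
part, see `ofPowerSeries_beta`. -/
def beta : PowerSeries ℚ := PowerSeries.mk fun n => betaLaurent.coeff n

theorem betaLaurent_eq : betaLaurent = HahnSeries.ofPowerSeries ℤ ℚ
    (PowerSeries.mk fun n => if n = 0 then 0 else -bernoulli (n + 1) / (2 * (n + 1)!)) := by
  set h : PowerSeries ℚ :=
    PowerSeries.mk fun n => if n = 0 then 0 else -bernoulli (n + 1) / (2 * (n + 1)!) with hh
  set P : PowerSeries ℚ := bernoulliPowerSeries ℚ with hP
  set u := PowerSeries.rescale (1 / 2 : ℚ) (PowerSeries.exp ℚ) with hu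
  set v := PowerSeries.rescale (-1 / 2 : ℚ) (PowerSeries.exp ℚ) with hv
  have huv : u * v = 1 := by
    rw [hu, hv, PowerSeries.exp_mul_exp_eq_exp_add]
    norm_num
  have huu : u * u = PowerSeries.exp ℚ := by
    rw [hu, PowerSeries.exp_mul_exp_eq_exp_add]
    norm_num
  have hPX : P * (PowerSeries.exp ℚ - 1) = PowerSeries.X := bernoulliPowerSeries_mul_exp_sub_one ℚ
  have hPuv : P * (u - v) = PowerSeries.X * v := by
    have h1 : (u - v) = (PowerSeries.exp ℚ - 1) * v := by
      rw [← huu]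
      linear_combination (-u) * huv
    rw [h1, ← mul_assoc, hPX]
  have hXh : 4 * (PowerSeries.X * h) = 2 - PowerSeries.X - 2 * P := by
    ext n
    have e4 : (4 : PowerSeries ℚ) = PowerSeries.C 4 := (map_ofNat _ 4).symm
    have e2 : (2 : PowerSeries ℚ) = PowerSeries.C 2 := (map_ofNat _ 2).symm
    rw [e4, e2, map_sub, map_sub, PowerSeries.coeff_C_mul, PowerSeries.coeff_C_mul,
      PowerSeries.coeff_C, PowerSeries.coeff_X]
    have hPn : PowerSeries.coeff n P = bernoulli n / n ! := by
      simp [hP, bernoulliPowerSeries]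
    rw [hPn]
    rcases n with _ | n
    · simp
    · rw [PowerSeries.coeff_succ_X_mul, hh, PowerSeries.coeff_mk]
      rcases n with _ | n
      · norm_num [bernoulli_one]
      · have hf : ((n + 1 + 1)! : ℚ) ≠ 0 := by positivity
        simp
        field_simp
        ring
  have hX0 : HahnSeries.ofPowerSeries ℤ ℚ PowerSeries.X ≠ 0 := by
    intro h0
    exact PowerSeries.X_ne_zero (HahnSeries.ofPowerSeries_injective (h0.trans (map_zero _).symm))
  have hv0 : v ≠ 0 := by
    intro h0
    rw [h0, mul_zero] at huv
    exact zero_ne_one huv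
  have hw0 : HahnSeries.ofPowerSeries ℤ ℚ (u - v) ≠ 0 := by
    intro h0
    have h1 : u - v = 0 := HahnSeries.ofPowerSeries_injective (h0.trans (map_zero _).symm)
    rw [h1, mul_zero] at hPuv
    exact mul_ne_zero PowerSeries.X_ne_zero hv0 hPuv.symm
  have main : (4 : PowerSeries ℚ) * (PowerSeries.X * (u - v) * h)
      = -(PowerSeries.X * (u + v)) + 2 * (u - v) := by
    linear_combination (u - v) * hXh - 2 * hPuv
  have main' := congrArg (HahnSeries.ofPowerSeries ℤ ℚ) main
  simp only [map_mul, map_add, map_neg, map_ofNat] at main'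
  have c4 : (HahnSeries.C (1 / 4 : ℚ) : LaurentSeries ℚ) = 1 / 4 := by
    rw [map_div₀]
    simp
  have c2 : (HahnSeries.C (1 / 2 : ℚ) : LaurentSeries ℚ) = 1 / 2 := by
    rw [map_div₀]
    simp
  rw [betaLaurent, cothHalf, c4, c2, ← hu, ← hv, map_add]
  have h4 : (4 : LaurentSeries ℚ) ≠ 0 := by
    have hc : (4 : LaurentSeries ℚ) = HahnSeries.C 4 := (map_ofNat _ 4).symm
    rw [hc]
    exact HahnSeries.C_ne_zero (by norm_num)
  have h2 : (2 : LaurentSeries ℚ) ≠ 0 := by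
    have hc : (2 : LaurentSeries ℚ) = HahnSeries.C 2 := (map_ofNat _ 2).symm
    rw [hc]
    exact HahnSeries.C_ne_zero (by norm_num)
  have h42 : (4 : LaurentSeries ℚ) * (1 / 2) = 2 := by
    rw [mul_one_div, div_eq_iff h2]
    norm_num
  have h44 : (4 : LaurentSeries ℚ) * (1 / 4) = 1 := mul_one_div_cancel h4
  apply mul_left_cancel₀ (mul_ne_zero h4 (mul_ne_zero hX0 hw0))
  generalize HahnSeries.ofPowerSeries ℤ ℚ (u - v) = w at *
  generalize HahnSeries.ofPowerSeries ℤ ℚ PowerSeries.X = x at *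
  generalize HahnSeries.ofPowerSeries ℤ ℚ u + HahnSeries.ofPowerSeries ℤ ℚ v = s at *
  generalize (1 / 2 : LaurentSeries ℚ) = a at *
  generalize (1 / 4 : LaurentSeries ℚ) = b at *
  have hs : w * (s / w) = s := mul_div_cancel₀ _ hw0
  have hx : x * x⁻¹ = 1 := mul_inv_cancel₀ hX0
  linear_combination (-4 * b * x) * hs - x * s * h44 + 4 * a * w * hx + w * h42 - main'

/-- The principal part of `-(1/4) coth (X / 2) + 1 / (2 X)` vanishes. -/
theorem ofPowerSeries_beta : HahnSeries.ofPowerSeries ℤ ℚ beta = betaLaurent := by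
  rw [betaLaurent_eq, beta, betaLaurent_eq]
  congr 1
  ext n
  rw [PowerSeries.coeff_mk, LaurentSeries.coeff_coe_powerSeries]

/-- `𝔟₁(X; Y) = -(1/4) (coth (X / 2) + coth (Y / 2)) + (1/2) (1 / X + 1 / Y)`. -/
def b1 : MvPowerSeries (Fin 2) ℚ :=
  beta.subst (MvPowerSeries.X 0 : MvPowerSeries (Fin 2) ℚ)
    + beta.subst (MvPowerSeries.X 1 : MvPowerSeries (Fin 2) ℚ)

/-- `𝔓_𝔟(X₁, X₂; Y₁, Y₂) = 𝔟₁(X₁; Y₁) 𝔟₁(X₂; Y₂)`. -/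
def Pb : MvPowerSeries (Fin 4) ℚ := ev2 b1 X₁ Y₁ * ev2 b1 X₂ Y₂

/-- The power series `𝔟₂(X₁, X₂; Y₁, Y₂)`. -/
def b2 : MvPowerSeries (Fin 4) ℚ :=
  (1 / 3 : ℚ) • Pb
  + (1 / 3 : ℚ) • ev4 Pb (X₁ - X₂) X₂ Y₁ (Y₁ + Y₂)
  - (5 / 12 : ℚ) • ev4 (shuffleQuot b1) (X₁ - X₂) X₂ Y₁ (Y₁ + Y₂)
  - (1 / 12 : ℚ) • ev4 (shuffleQuot b1) (-X₂) X₁ (-Y₂) Y₁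
  + (1 / 4 : ℚ) • ev4 (shuffleQuot b1) (X₂ - X₁) X₁ Y₂ (Y₁ + Y₂)
  - (5 / 12 : ℚ) • stuffleQuot b1
  - (1 / 12 : ℚ) • ev4 (stuffleQuot b1) (X₂ - X₁) X₂ (-Y₁) (Y₁ + Y₂)
  + (1 / 4 : ℚ) • ev4 (stuffleQuot b1) (X₁ - X₂) X₁ (-Y₂) (Y₁ + Y₂)

/-! ### The `q`-series and their generating series -/

/-- `g(k; d) = ∑_{m, n > 0} m^d n^(k-1) / (k-1)! q^(m n)`, for `k ≥ 1`. -/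
def gq (k d : ℕ) : PowerSeries ℚ :=
  PowerSeries.mk fun N => ∑ p ∈ N.divisorsAntidiagonal,
    (p.1 : ℚ) ^ d * (p.2 : ℚ) ^ (k - 1) / (k - 1)!

/-- `g(k₁, k₂; d₁, d₂)`, the sum over `m₁ > m₂ > 0` and `n₁, n₂ > 0` of
`m₁^d₁ n₁^(k₁-1) / (k₁-1)! * m₂^d₂ n₂^(k₂-1) / (k₂-1)! q^(m₁ n₁ + m₂ n₂)`, for `k₁, k₂ ≥ 1`. In the
coefficient of `q^N` one has `N = s.1 + s.2`, `p = (m₁, n₁)`, `m₁ n₁ = s.1`, `r = (m₂, n₂)`,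
`m₂ n₂ = s.2`. -/
def gq2 (k₁ k₂ d₁ d₂ : ℕ) : PowerSeries ℚ :=
  PowerSeries.mk fun N => ∑ s ∈ Finset.HasAntidiagonal.antidiagonal N,
    ∑ p ∈ s.1.divisorsAntidiagonal, ∑ r ∈ s.2.divisorsAntidiagonal,
      if r.1 < p.1 then
        ((p.1 : ℚ) ^ d₁ * (p.2 : ℚ) ^ (k₁ - 1) / (k₁ - 1)!)
          * ((r.1 : ℚ) ^ d₂ * (r.2 : ℚ) ^ (k₂ - 1) / (k₂ - 1)!)
      else 0

/-- `𝔤₁(X; Y) = ∑_{k ≥ 1, d ≥ 0} g(k; d) X^(k-1) Y^d / d!`. -/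
def g1 : MvPowerSeries (Fin 2) (PowerSeries ℚ) :=
  fun e => (1 / (e 1)! : ℚ) • gq (e 0 + 1) (e 1)

/-- `𝔤₂(X₁, X₂; Y₁, Y₂)`, the sum over `k₁, k₂ ≥ 1` and `d₁, d₂ ≥ 0` of
`g(k₁, k₂; d₁, d₂) X₁^(k₁-1) X₂^(k₂-1) Y₁^d₁ / d₁! Y₂^d₂ / d₂!`. -/
def g2 : MvPowerSeries (Fin 4) (PowerSeries ℚ) :=
  fun e => (1 / ((e 2)! * (e 3)!) : ℚ) • gq2 (e 0 + 1) (e 1 + 1) (e 2) (e 3)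

/-- `𝔟₁` with coefficients regarded as constant `q`-series. -/
def b1q : MvPowerSeries (Fin 2) (PowerSeries ℚ) := b1.map (algebraMap ℚ (PowerSeries ℚ))

/-- `𝔟₂` with coefficients regarded as constant `q`-series. -/
def b2q : MvPowerSeries (Fin 4) (PowerSeries ℚ) := b2.map (algebraMap ℚ (PowerSeries ℚ))

/-- `𝔈₁ = 𝔟₁ + 𝔤₁`. -/
def E1 : MvPowerSeries (Fin 2) (PowerSeries ℚ) := b1q + g1

/-- The power series `𝔈₂(X₁, X₂; Y₁, Y₂)`. -/
def E2 : MvPowerSeries (Fin 4) (PowerSeries ℚ) :=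
  b2q
  - ev2 b1q (X₁ - X₂) Y₂ * ev2 g1 X₁ (Y₁ + Y₂)
  - (1 / 2 : ℚ) • ev2 g1 X₁ (Y₁ + Y₂)
  + ev2 b1q X₂ Y₂ * ev2 g1 X₁ Y₁
  + ev2 b1q (X₁ - X₂) Y₁ * ev2 g1 X₂ (Y₁ + Y₂)
  + g2

/-- `𝔓_𝔈(X₁, X₂; Y₁, Y₂) = 𝔈₁(X₁; Y₁) 𝔈₁(X₂; Y₂)`. -/
def PE : MvPowerSeries (Fin 4) (PowerSeries ℚ) := ev2 E1 X₁ Y₁ * ev2 E1 X₂ Y₂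

/-- The operator `q d/dq` on `ℚ⟦q⟧`. -/
def qDeriv (f : PowerSeries ℚ) : PowerSeries ℚ := PowerSeries.X * PowerSeries.derivative ℚ f

/-- The normalized Eisenstein series
`G̃_k = -B_k / (2 k!) + 1 / (k-1)! ∑_{n > 0} σ_{k-1}(n) q^n` for `k ≥ 2`, and `G̃_1 = g(1)`. -/
def Gtilde (k : ℕ) : PowerSeries ℚ :=
  if k = 1 then gq 1 0
  else PowerSeries.C (-bernoulli k / (2 * k !))
    + PowerSeries.mk fun n => (1 / (k - 1)! : ℚ) * (ArithmeticFunction.sigma (k - 1) n : ℚ)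

/-! ### The formal double Eisenstein space -/

/-- Formal symbols `G(k; d)`, `G(k₁, k₂; d₁, d₂)` and `P(k₁, k₂; d₁, d₂)`. -/
inductive Symb : Type
  | G1 (k d : ℕ)
  | G2 (k₁ k₂ d₁ d₂ : ℕ)
  | P (k₁ k₂ d₁ d₂ : ℕ)

/-- The symbols of weight `K`; the upper indices are at least one. -/
def Symb.IsGen (K : ℕ) : Symb → Prop
  | .G1 k d => 1 ≤ k ∧ k + d = K
  | .G2 k₁ k₂ d₁ d₂ => 1 ≤ k₁ ∧ 1 ≤ k₂ ∧ k₁ + k₂ + d₁ + d₂ = K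
  | .P k₁ k₂ d₁ d₂ => 1 ≤ k₁ ∧ 1 ≤ k₂ ∧ k₁ + k₂ + d₁ + d₂ = K

/-- The `ℚ`-vector space with basis the symbols of weight `K`. -/
abbrev Free (K : ℕ) : Type := {s : Symb // s.IsGen K} →₀ ℚ

open Classical in
/-- The basis vector of a symbol of weight `K` (and `0` for all other symbols, which do not occur
in the relations of weight `K`). -/
def gen (K : ℕ) (s : Symb) : Free K := if h : s.IsGen K then Finsupp.single ⟨s, h⟩ 1 else 0

/-- The element `G(k₁,k₂;d₁,d₂) + G(k₂,k₁;d₂,d₁) + G(k₁+k₂;d₁+d₂)`. -/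
def stuffleSide (K k₁ k₂ d₁ d₂ : ℕ) : Free K :=
  gen K (.G2 k₁ k₂ d₁ d₂) + gen K (.G2 k₂ k₁ d₂ d₁) + gen K (.G1 (k₁ + k₂) (d₁ + d₂))

/-- The coefficient of `G(l₁,l₂;e₁,e₂)` in the shuffle product. The exponents `d - e₁` are
truncated only where the binomial coefficient in front of the sign vanishes. -/
def shuffleCoeff (k₁ k₂ d₁ d₂ l₁ e₁ : ℕ) : ℚ :=
  ((l₁ - 1).choose (k₁ - 1) : ℚ) * (d₁.choose e₁ : ℚ) * (-1) ^ (d₁ - e₁)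
    + ((l₁ - 1).choose (k₂ - 1) : ℚ) * (d₂.choose e₁ : ℚ) * (-1) ^ (d₂ - e₁)

/-- The sum over `l₁ + l₂ = k₁ + k₂` with `l₁, l₂ ≥ 1` and `e₁ + e₂ = d₁ + d₂` of
`shuffleCoeff * G(l₁,l₂;e₁,e₂)`, plus
`d₁! d₂! / (d₁+d₂+1)! * binom(k₁+k₂-2, k₁-1) * G(k₁+k₂-1; d₁+d₂+1)`. -/
def shuffleSide (K k₁ k₂ d₁ d₂ : ℕ) : Free K :=
  (∑ l ∈ (Finset.HasAntidiagonal.antidiagonal (k₁ + k₂)).filter (fun l => 1 ≤ l.1 ∧ 1 ≤ l.2),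
    ∑ e ∈ Finset.HasAntidiagonal.antidiagonal (d₁ + d₂),
      shuffleCoeff k₁ k₂ d₁ d₂ l.1 e.1 • gen K (.G2 l.1 l.2 e.1 e.2))
  + ((d₁ ! * d₂ ! : ℚ) / (d₁ + d₂ + 1)! * ((k₁ + k₂ - 2).choose (k₁ - 1) : ℚ)) •
      gen K (.G1 (k₁ + k₂ - 1) (d₁ + d₂ + 1))

/-- The subspace of relations `P = stuffleSide` and `P = shuffleSide` of weight `K`. -/
def relations (K : ℕ) : Submodule ℚ (Free K) :=
  Submodule.span ℚ {x | ∃ k₁ k₂ d₁ d₂ : ℕ, 1 ≤ k₁ ∧ 1 ≤ k₂ ∧ k₁ + k₂ + d₁ + d₂ = K ∧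
    (x = gen K (.P k₁ k₂ d₁ d₂) - stuffleSide K k₁ k₂ d₁ d₂ ∨
      x = gen K (.P k₁ k₂ d₁ d₂) - shuffleSide K k₁ k₂ d₁ d₂)}

/-- The formal double Eisenstein space of weight `K`. -/
abbrev DE (K : ℕ) : Type := Free K ⧸ relations K

/-- The class of a symbol of weight `K` in the formal double Eisenstein space. -/
def DE.of (K : ℕ) (s : Symb) : DE K := (relations K).mkQ (gen K s)

end DoubleEisenstein

end

open DoubleEisenstein

/-!
The two equations for `𝔈₁` and `𝔈₂` split into an identity for the Bernoulli part `𝔟₁`, `𝔟₂` over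
`ℚ` and an identity for the `q`-series `𝔤₁`, `𝔤₂`. Both rest on one property of
`β(X) = -(1/4) coth (X / 2) + 1 / (2 X)`, the functional equation
`(2 - X - 4 X β(X)) (e^X - 1) = 2 X`. All divisions are avoided by cancelling nonzero factors in the
domains `ℚ⟦X₁, X₂, Y₁, Y₂⟧` and `ℚ⟦q⟧⟦X₁, X₂, Y₁, Y₂⟧`.

For the Bernoulli part, the functional equation shows that `β` is odd and gives the addition theorem
of the hyperbolic cotangent for `u + v + w = 0`, which in terms of `β` and its difference quotients
is `betaQuot_triple`. The difference of the two sides of either equation of `𝔟₁`, `𝔟₂` is a multiple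
of the addition theorem for three linear forms in `X₁, X₂` minus that for three linear forms in
`Y₁, Y₂`, so that the constant terms cancel (`b2_stuffle`, `b2_shuffle`).

For the `q`-series, the coefficient of `q^N` in `𝔤₁` and `𝔤₂` is a finite sum of exponentials of
linear forms, indexed by `m n = N` and `m₁ n₁ + m₂ n₂ = N`. The product `𝔤₁(X₁; Y₁) 𝔤₁(X₂; Y₂)` is
divided according to the order of `m₁` and `m₂` for the first equation and to the order of `n₁` and
`n₂` for the second one; the two halves are values of `𝔤₂`, in the second case by
`sum_quads_shear`. The diagonal terms are geometric sums with denominator `e^D - 1`, where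
`D = X₁ - X₂` or `D = Y₁ - Y₂`, and the functional equation turns them into the difference quotient
of `𝔤₁` and the products with `𝔟₁` in `𝔈₂` (`g1_mul_g1_stuffle`, `g1_mul_g1_shuffle`). This gives
`PE_stuffle` and `PE_shuffle`.

Comparing coefficients in these two equations shows that the prescribed values of the symbols respect
the relations of the formal double Eisenstein space, whence the realization exists; it is unique as
the symbols generate. The values of `G(k; d)` for `k > d` and of `P(k₁, k₂; 0, 0)` follow from the
coefficients of `β`, which are Bernoulli numbers, and from `m^d n^(k-1) = (m n)^d n^(k-d-1)`.
-/

open DoubleEisenstein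

noncomputable section

namespace DoubleEisenstein

/-! ### Substitution into power series in two and four variables -/

section Substitution

variable {R : Type} [CommRing R]

theorem hasSubst_pair {n : ℕ} {x y : MvPowerSeries (Fin n) R} (hx : x.constantCoeff = 0)
    (hy : y.constantCoeff = 0) : MvPowerSeries.HasSubst ![x, y] :=
  hasSubst_vec _ (by intro i; fin_cases i <;> simp [hx, hy])

theorem hasSubst_triple {n : ℕ} {x y z : MvPowerSeries (Fin n) R} (hx : x.constantCoeff = 0)
    (hy : y.constantCoeff = 0) (hz : z.constantCoeff = 0) : MvPowerSeries.HasSubst ![x, y, z] :=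
  hasSubst_vec _ (by intro i; fin_cases i <;> simp [hx, hy, hz])

theorem hasSubst_quad {n : ℕ} {x₁ x₂ y₁ y₂ : MvPowerSeries (Fin n) R}
    (h1 : x₁.constantCoeff = 0) (h2 : x₂.constantCoeff = 0) (h3 : y₁.constantCoeff = 0)
    (h4 : y₂.constantCoeff = 0) : MvPowerSeries.HasSubst ![x₁, x₂, y₁, y₂] :=
  hasSubst_vec _ (by intro i; fin_cases i <;> simp [h1, h2, h3, h4])

theorem powerSeries_hasSubst {n : ℕ} {x : MvPowerSeries (Fin n) R} (hx : x.constantCoeff = 0) :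
    PowerSeries.HasSubst x :=
  PowerSeries.HasSubst.of_constantCoeff_zero hx

section

variable {x y : MvPowerSeries (Fin 4) R} (hx : x.constantCoeff = 0) (hy : y.constantCoeff = 0)

include hx hy

theorem ev2_add (f g : MvPowerSeries (Fin 2) R) : ev2 (f + g) x y = ev2 f x y + ev2 g x y :=
  MvPowerSeries.subst_add (hasSubst_pair hx hy) f g

end

section

variable {x₁ x₂ y₁ y₂ : MvPowerSeries (Fin 4) R}
  (h1 : x₁.constantCoeff = 0) (h2 : x₂.constantCoeff = 0) (h3 : y₁.constantCoeff = 0)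
  (h4 : y₂.constantCoeff = 0)

include h1 h2 h3 h4

theorem ev4_add (f g : MvPowerSeries (Fin 4) R) :
    ev4 (f + g) x₁ x₂ y₁ y₂ = ev4 f x₁ x₂ y₁ y₂ + ev4 g x₁ x₂ y₁ y₂ :=
  MvPowerSeries.subst_add (hasSubst_quad h1 h2 h3 h4) f g

theorem ev4_sub (f g : MvPowerSeries (Fin 4) R) :
    ev4 (f - g) x₁ x₂ y₁ y₂ = ev4 f x₁ x₂ y₁ y₂ - ev4 g x₁ x₂ y₁ y₂ :=
  MvPowerSeries.subst_sub (hasSubst_quad h1 h2 h3 h4) f g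

theorem ev4_neg (f : MvPowerSeries (Fin 4) R) :
    ev4 (-f) x₁ x₂ y₁ y₂ = -ev4 f x₁ x₂ y₁ y₂ := by
  have h := ev4_add h1 h2 h3 h4 f (-f)
  have h0 := ev4_add h1 h2 h3 h4 0 0
  rw [add_neg_cancel] at h
  rw [add_zero, left_eq_add] at h0
  rw [h0] at h
  exact eq_neg_of_add_eq_zero_right h.symm

theorem ev4_mul (f g : MvPowerSeries (Fin 4) R) :
    ev4 (f * g) x₁ x₂ y₁ y₂ = ev4 f x₁ x₂ y₁ y₂ * ev4 g x₁ x₂ y₁ y₂ :=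
  MvPowerSeries.subst_mul (hasSubst_quad h1 h2 h3 h4) f g

theorem ev4_smul [Algebra ℚ R] (c : ℚ) (f : MvPowerSeries (Fin 4) R) :
    ev4 (c • f) x₁ x₂ y₁ y₂ = c • ev4 f x₁ x₂ y₁ y₂ :=
  MvPowerSeries.subst_smul (hasSubst_quad h1 h2 h3 h4) c f

theorem ev4_X₁ : ev4 X₁ x₁ x₂ y₁ y₂ = x₁ :=
  MvPowerSeries.subst_X (hasSubst_quad h1 h2 h3 h4) 0

theorem ev4_X₂ : ev4 X₂ x₁ x₂ y₁ y₂ = x₂ :=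
  MvPowerSeries.subst_X (hasSubst_quad h1 h2 h3 h4) 1

theorem ev4_Y₁ : ev4 Y₁ x₁ x₂ y₁ y₂ = y₁ :=
  MvPowerSeries.subst_X (hasSubst_quad h1 h2 h3 h4) 2

theorem ev4_Y₂ : ev4 Y₂ x₁ x₂ y₁ y₂ = y₂ :=
  MvPowerSeries.subst_X (hasSubst_quad h1 h2 h3 h4) 3

theorem ev4_ev2 (f : MvPowerSeries (Fin 2) R) {x y : MvPowerSeries (Fin 4) R}
    (hx : x.constantCoeff = 0) (hy : y.constantCoeff = 0) :
    ev4 (ev2 f x y) x₁ x₂ y₁ y₂ = ev2 f (ev4 x x₁ x₂ y₁ y₂) (ev4 y x₁ x₂ y₁ y₂) := by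
  rw [ev4, ev2, MvPowerSeries.subst_comp_subst_apply (hasSubst_pair hx hy)
    (hasSubst_quad h1 h2 h3 h4), ev2]
  congr 1
  funext k
  fin_cases k <;> rfl

theorem ev4_subst_triple (f : MvPowerSeries (Fin 3) R) {x y z : MvPowerSeries (Fin 4) R}
    (hx : x.constantCoeff = 0) (hy : y.constantCoeff = 0) (hz : z.constantCoeff = 0) :
    ev4 (f.subst ![x, y, z]) x₁ x₂ y₁ y₂
      = f.subst ![ev4 x x₁ x₂ y₁ y₂, ev4 y x₁ x₂ y₁ y₂, ev4 z x₁ x₂ y₁ y₂] := by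
  rw [ev4, MvPowerSeries.subst_comp_subst_apply (hasSubst_triple hx hy hz)
    (hasSubst_quad h1 h2 h3 h4)]
  congr 1
  funext k
  fin_cases k <;> rfl

theorem ev4_ev4 (f : MvPowerSeries (Fin 4) R) {z₁ z₂ w₁ w₂ : MvPowerSeries (Fin 4) R}
    (k1 : z₁.constantCoeff = 0) (k2 : z₂.constantCoeff = 0) (k3 : w₁.constantCoeff = 0)
    (k4 : w₂.constantCoeff = 0) :
    ev4 (ev4 f z₁ z₂ w₁ w₂) x₁ x₂ y₁ y₂
      = ev4 f (ev4 z₁ x₁ x₂ y₁ y₂) (ev4 z₂ x₁ x₂ y₁ y₂) (ev4 w₁ x₁ x₂ y₁ y₂)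
          (ev4 w₂ x₁ x₂ y₁ y₂) := by
  rw [ev4, ev4, MvPowerSeries.subst_comp_subst_apply (hasSubst_quad k1 k2 k3 k4)
    (hasSubst_quad h1 h2 h3 h4), ev4]
  congr 1
  funext k
  fin_cases k <;> rfl

end

theorem ev4_self (f : MvPowerSeries (Fin 4) R) : ev4 f X₁ X₂ Y₁ Y₂ = f := by
  have h : (![X₁, X₂, Y₁, Y₂] : Fin 4 → MvPowerSeries (Fin 4) R) = MvPowerSeries.X := by
    funext k
    fin_cases k <;> rfl
  rw [ev4, h, MvPowerSeries.subst_self, id]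

end Substitution

/-! ### Exponentials of multivariate power series -/

section Exponential

variable {n : ℕ}

/-- The exponential `e^u` of a power series `u` without constant term. -/
def expSubst (u : MvPowerSeries (Fin n) ℚ) : MvPowerSeries (Fin n) ℚ :=
  (PowerSeries.exp ℚ).subst u

theorem exp_subst_X_add_X :
    (PowerSeries.exp ℚ).subst (MvPowerSeries.X 0 + MvPowerSeries.X 1 : MvPowerSeries (Fin 2) ℚ)
      = (PowerSeries.exp ℚ).subst (MvPowerSeries.X 0 : MvPowerSeries (Fin 2) ℚ)
        * (PowerSeries.exp ℚ).subst (MvPowerSeries.X 1 : MvPowerSeries (Fin 2) ℚ) := by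
  ext e
  rw [PowerSeries.coeff_subst_X_zero_add_X_one, PowerSeries.coeff_subst_X_zero_subst_mul_X_one,
    PowerSeries.coeff_exp, PowerSeries.coeff_exp, PowerSeries.coeff_exp,
    Nat.cast_add_choose ℚ]
  simp only [Algebra.algebraMap_self, RingHom.id_apply]
  have h : ((e 0 + e 1)! : ℚ) ≠ 0 := by positivity
  have h' : ((e 0)! : ℚ) ≠ 0 := by positivity
  have h'' : ((e 1)! : ℚ) ≠ 0 := by positivity
  field_simp

theorem subst_subst_X {m : ℕ} (f : PowerSeries ℚ) {a : Fin m → MvPowerSeries (Fin n) ℚ}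
    (ha : MvPowerSeries.HasSubst a) (i : Fin m) :
    (f.subst (MvPowerSeries.X i : MvPowerSeries (Fin m) ℚ)).subst a = f.subst (a i) := by
  rw [PowerSeries.subst, MvPowerSeries.subst_comp_subst_apply
    (PowerSeries.HasSubst.const (PowerSeries.HasSubst.X i)) ha, PowerSeries.subst]
  congr 1
  funext k
  exact MvPowerSeries.subst_X ha i

theorem subst_subst {m : ℕ} (f : PowerSeries ℚ) {a : Fin m → MvPowerSeries (Fin n) ℚ}
    (ha : MvPowerSeries.HasSubst a) {u : MvPowerSeries (Fin m) ℚ} (hu : u.constantCoeff = 0) :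
    (f.subst u).subst a = f.subst (u.subst a) := by
  rw [PowerSeries.subst, MvPowerSeries.subst_comp_subst_apply
    (PowerSeries.HasSubst.const (powerSeries_hasSubst hu)) ha, PowerSeries.subst]

theorem expSubst_add {u v : MvPowerSeries (Fin n) ℚ} (hu : u.constantCoeff = 0)
    (hv : v.constantCoeff = 0) : expSubst (u + v) = expSubst u * expSubst v := by
  have ha : MvPowerSeries.HasSubst ![u, v] := hasSubst_pair hu hv
  have h := congrArg (MvPowerSeries.subst ![u, v]) exp_subst_X_add_X
  rw [MvPowerSeries.subst_mul ha, subst_subst_X _ ha, subst_subst_X _ ha,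
    subst_subst _ ha (by simp), MvPowerSeries.subst_add ha, MvPowerSeries.subst_X ha,
    MvPowerSeries.subst_X ha] at h
  exact h

theorem expSubst_zero : expSubst (0 : MvPowerSeries (Fin n) ℚ) = 1 := by
  rw [expSubst, PowerSeries.subst_zero_eq_C_constantCoeff]
  simp

end Exponential

/-! ### The series `β` and the addition theorem for the hyperbolic cotangent -/

theorem coeff_beta (n : ℕ) :
    PowerSeries.coeff n beta = if n = 0 then 0 else -bernoulli (n + 1) / (2 * (n + 1)!) := by
  rw [beta, betaLaurent_eq, PowerSeries.coeff_mk, LaurentSeries.coeff_coe_powerSeries,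
    PowerSeries.coeff_mk]

/-- The functional equation `(2 - X - 4 X β(X)) (e^X - 1) = 2 X`, which expresses that
`2 - X - 4 X β(X)` is twice the generating series of the Bernoulli numbers. -/
theorem two_sub_X_sub_beta_mul_exp_sub_one :
    (2 - PowerSeries.X - 4 * (PowerSeries.X * beta)) * (PowerSeries.exp ℚ - 1)
      = 2 * PowerSeries.X := by
  have h : (2 - PowerSeries.X - 4 * (PowerSeries.X * beta)) = 2 * bernoulliPowerSeries ℚ := by
    ext n
    have e4 : (4 : PowerSeries ℚ) = PowerSeries.C 4 := (map_ofNat _ 4).symm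
    have e2 : (2 : PowerSeries ℚ) = PowerSeries.C 2 := (map_ofNat _ 2).symm
    rw [e4, e2, map_sub, map_sub, PowerSeries.coeff_C_mul, PowerSeries.coeff_C_mul,
      PowerSeries.coeff_C, PowerSeries.coeff_X]
    have hPn : PowerSeries.coeff n (bernoulliPowerSeries ℚ) = bernoulli n / n ! := by
      simp [bernoulliPowerSeries]
    rw [hPn]
    rcases n with _ | n
    · simp
    · rw [PowerSeries.coeff_succ_X_mul, coeff_beta]
      rcases n with _ | n
      · norm_num [bernoulli_one]
      · have hf : ((n + 1 + 1)! : ℚ) ≠ 0 := by positivity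
        simp
        field_simp
        ring
  rw [h, mul_assoc, bernoulliPowerSeries_mul_exp_sub_one]

section Beta

variable {n : ℕ}

/-- The power series `β(u)`, where `β(X) = -(1/4) coth (X / 2) + 1 / (2 X)`. -/
def betaSubst (u : MvPowerSeries (Fin n) ℚ) : MvPowerSeries (Fin n) ℚ :=
  beta.subst u

theorem four_ne_zero_mvPowerSeries : (4 : MvPowerSeries (Fin n) ℚ) ≠ 0 := by
  intro h
  have := congrArg MvPowerSeries.constantCoeff h
  rw [map_ofNat, map_zero] at this
  norm_num at this

theorem betaSubst_mul_expSubst_sub_one {u : MvPowerSeries (Fin n) ℚ} (hu : u.constantCoeff = 0) :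
    (2 - u - 4 * (u * betaSubst u)) * (expSubst u - 1) = 2 * u := by
  have hs := powerSeries_hasSubst hu
  have h := congrArg (PowerSeries.substAlgHom hs) two_sub_X_sub_beta_mul_exp_sub_one
  simp only [map_mul, map_sub, map_one, map_ofNat, PowerSeries.substAlgHom_X,
    PowerSeries.coe_substAlgHom] at h
  exact h

theorem expSubst_ne_one {u : MvPowerSeries (Fin n) ℚ} (hu : u.constantCoeff = 0) (h0 : u ≠ 0) :
    expSubst u - 1 ≠ 0 := by
  intro h
  have h' := betaSubst_mul_expSubst_sub_one hu
  rw [h, mul_zero] at h'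
  exact mul_ne_zero four_ne_zero_mvPowerSeries h0 (by linear_combination -2 * h')

theorem betaSubst_neg {u : MvPowerSeries (Fin n) ℚ} (hu : u.constantCoeff = 0) :
    betaSubst (-u) = -betaSubst u := by
  have hu' : (-u).constantCoeff = 0 := by simp [hu]
  have hs := powerSeries_hasSubst hu
  have hs' := powerSeries_hasSubst hu'
  by_cases h0 : u = 0
  · subst h0
    have : betaSubst (0 : MvPowerSeries (Fin n) ℚ) = 0 := by
      rw [betaSubst, PowerSeries.subst_zero_of_constantCoeff_zero]
      rw [← PowerSeries.coeff_zero_eq_constantCoeff_apply, coeff_beta, if_pos rfl]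
    rw [neg_zero, this, neg_zero]
  · have k1 := betaSubst_mul_expSubst_sub_one hu
    have k2 := betaSubst_mul_expSubst_sub_one hu'
    have k3 : expSubst u * expSubst (-u) = 1 := by
      rw [← expSubst_add hu hu', add_neg_cancel, expSubst_zero]
    have hn := expSubst_ne_one hu h0
    have h4 : (4 : MvPowerSeries (Fin n) ℚ) ≠ 0 := four_ne_zero_mvPowerSeries
    have key : (4 * (expSubst u - 1) * u) * (betaSubst (-u) + betaSubst u) = 0 := by
      linear_combination (-expSubst u) * k2 - k1 + (2 + u + 4 * (u * betaSubst (-u))) * k3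
    have := (mul_eq_zero.mp key).resolve_left (mul_ne_zero (mul_ne_zero h4 hn) h0)
    exact eq_neg_of_add_eq_zero_left this

/-- The addition theorem
`coth (u/2) coth (v/2) + coth (v/2) coth (w/2) + coth (w/2) coth (u/2) = -1` for `u + v + w = 0`,
with `coth (X / 2)` replaced by `2 / X - 4 β(X)` and the denominators cleared. -/
theorem betaSubst_triple {u v w : MvPowerSeries (Fin n) ℚ} (hu : u.constantCoeff = 0)
    (hv : v.constantCoeff = 0) (hw : w.constantCoeff = 0) (hu0 : u ≠ 0) (hv0 : v ≠ 0)
    (hw0 : w ≠ 0) (huvw : u + v + w = 0) :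
    16 * (u * v * w) * (betaSubst u * betaSubst v + betaSubst v * betaSubst w
        + betaSubst w * betaSubst u)
      + 8 * (u ^ 2 * betaSubst u + v ^ 2 * betaSubst v + w ^ 2 * betaSubst w)
      + u * v * w = 0 := by
  have k1 := betaSubst_mul_expSubst_sub_one hu
  have k2 := betaSubst_mul_expSubst_sub_one hv
  have k3 := betaSubst_mul_expSubst_sub_one hw
  have ke : expSubst u * expSubst v * expSubst w = 1 := by
    rw [← expSubst_add hu hv, ← expSubst_add (by simp [hu, hv]) hw, huvw, expSubst_zero]
  have n1 := expSubst_ne_one hu hu0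
  have n2 := expSubst_ne_one hv hv0
  have n3 := expSubst_ne_one hw hw0
  -- With `c u = 2 - 4 u β(u) = u coth (u / 2)`, one has `c u * (e^u - 1) = u * (e^u + 1)`.
  generalize hcu : 2 - 4 * (u * betaSubst u) = cu at *
  generalize hcv : 2 - 4 * (v * betaSubst v) = cv at *
  generalize hcw : 2 - 4 * (w * betaSubst w) = cw at *
  have l1 : cu * (expSubst u - 1) = u * (expSubst u + 1) := by
    rw [← hcu]; linear_combination k1
  have l2 : cv * (expSubst v - 1) = v * (expSubst v + 1) := by
    rw [← hcv]; linear_combination k2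
  have l3 : cw * (expSubst w - 1) = w * (expSubst w + 1) := by
    rw [← hcw]; linear_combination k3
  have key : (expSubst u - 1) * (expSubst v - 1) * (expSubst w - 1)
      * (cu * cv * w + cv * cw * u + cw * cu * v + u * v * w) = 0 := by
    generalize expSubst u = a at *
    generalize expSubst v = b at *
    generalize expSubst w = c at *
    have e12 : (cu * cv) * ((a - 1) * (b - 1)) = u * v * ((a + 1) * (b + 1)) := by
      linear_combination (cv * (b - 1)) * l1 + u * (a + 1) * l2
    have e23 : (cv * cw) * ((b - 1) * (c - 1)) = v * w * ((b + 1) * (c + 1)) := by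
      linear_combination (cw * (c - 1)) * l2 + v * (b + 1) * l3
    have e31 : (cw * cu) * ((c - 1) * (a - 1)) = w * u * ((c + 1) * (a + 1)) := by
      linear_combination (cu * (a - 1)) * l3 + w * (c + 1) * l1
    linear_combination w * (c - 1) * e12 + u * (a - 1) * e23 + v * (b - 1) * e31
      + 4 * (u * v * w) * ke
  have key' := (mul_eq_zero.mp key).resolve_left (mul_ne_zero (mul_ne_zero n1 n2) n3)
  rw [← hcu, ← hcv, ← hcw] at key'
  linear_combination key' - 4 * huvw
    + 8 * (u * betaSubst u + v * betaSubst v + w * betaSubst w) * huvw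

end Beta

/-- The power series `(β(U) - β(V)) / (U - V)`; see `sub_mul_betaQuot`. -/
def betaDivDiff : MvPowerSeries (Fin 2) ℚ :=
  fun e => PowerSeries.coeff (e 0 + e 1 + 1) beta

/-- The power series `(β(u) - β(v)) / (u - v)`. -/
def betaQuot (u v : MvPowerSeries (Fin 4) ℚ) : MvPowerSeries (Fin 4) ℚ :=
  ev2 betaDivDiff u v

theorem coeff_b1 (a b : ℕ) : b1.coeff (expo2 a b)
    = (if b = 0 then PowerSeries.coeff a beta else 0)
      + (if a = 0 then PowerSeries.coeff b beta else 0) := by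
  classical
  have h0 : (expo2 a b = Finsupp.single 0 (expo2 a b 0)) ↔ b = 0 := by
    constructor
    · intro h
      have := DFunLike.congr_fun h 1
      simpa [expo2] using this
    · rintro rfl
      ext k
      fin_cases k <;> simp [expo2]
  have h1 : (expo2 a b = Finsupp.single 1 (expo2 a b 1)) ↔ a = 0 := by
    constructor
    · intro h
      have := DFunLike.congr_fun h 0
      simpa [expo2] using this
    · rintro rfl
      ext k
      fin_cases k <;> simp [expo2]
  rw [b1, map_add, PowerSeries.coeff_subst_single, PowerSeries.coeff_subst_single]
  simp only [h0, h1]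
  simp [expo2]

theorem ev2_b1 {x y : MvPowerSeries (Fin 4) ℚ} (hx : x.constantCoeff = 0)
    (hy : y.constantCoeff = 0) : ev2 b1 x y = betaSubst x + betaSubst y := by
  have ha := hasSubst_pair hx hy
  rw [ev2, b1, MvPowerSeries.subst_add ha, subst_subst_X _ ha, subst_subst_X _ ha]
  rfl

theorem expo2_apply (e : Fin 2 →₀ ℕ) : expo2 (e 0) (e 1) = e := by
  ext k
  fin_cases k <;> rfl

theorem flipXY_b1 : flipXY b1 = b1 := by
  ext e
  have h : (flipXY b1).coeff e = b1.coeff (expo2 (e 1) (e 0)) := rfl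
  rw [h, coeff_b1]
  conv_rhs => rw [← expo2_apply e, coeff_b1]
  ring

theorem divDiff_b1 : divDiff b1 = betaDivDiff.subst
    ![(MvPowerSeries.X 0 : MvPowerSeries (Fin 3) ℚ), MvPowerSeries.X 1] := by
  ext e
  have h : (divDiff b1).coeff e = b1.coeff (expo2 (e 0 + e 1 + 1) (e 2)) := rfl
  have h2 : (∀ k : Fin 3, k ≠ 0 → k ≠ 1 → e k = 0) ↔ e 2 = 0 := by
    constructor
    · intro h
      exact h 2 (by decide) (by decide)
    · intro h k
      fin_cases k <;> simp [h]
  rw [h, coeff_b1, subst_pair_coeff _ _ _ (by decide)]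
  simp only [h2]
  have h3 : betaDivDiff.coeff (expo2 (e 0) (e 1)) = PowerSeries.coeff (e 0 + e 1 + 1) beta := rfl
  simp [h3]

theorem divDiff_b1_subst {u v w : MvPowerSeries (Fin 4) ℚ} (hu : u.constantCoeff = 0)
    (hv : v.constantCoeff = 0) (hw : w.constantCoeff = 0) :
    (divDiff b1).subst ![u, v, w] = betaQuot u v := by
  rw [divDiff_b1, MvPowerSeries.subst_comp_subst_apply
    (hasSubst_pair (by simp) (by simp)) (hasSubst_triple hu hv hw), betaQuot, ev2]
  congr 1
  funext k
  fin_cases k <;> simp [MvPowerSeries.subst_X (hasSubst_triple hu hv hw)]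

theorem sub_mul_betaQuot {u v : MvPowerSeries (Fin 4) ℚ} (hu : u.constantCoeff = 0)
    (hv : v.constantCoeff = 0) : (u - v) * betaQuot u v = betaSubst u - betaSubst v := by
  have h := sub_mul_divDiff_subst b1 u v 0 hu hv (by simp)
  rw [divDiff_b1_subst hu hv (by simp), ev2_b1 hu (by simp), ev2_b1 hv (by simp)] at h
  linear_combination h

/-- The addition theorem for the hyperbolic cotangent in terms of `β` and its difference
quotients. -/
theorem betaQuot_triple {u v w : MvPowerSeries (Fin 4) ℚ} (hu : u.constantCoeff = 0)
    (hv : v.constantCoeff = 0) (hw : w.constantCoeff = 0) (hu0 : u ≠ 0) (hv0 : v ≠ 0)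
    (hw0 : w ≠ 0) (huvw : u + v + w = 0) :
    16 * (betaSubst u * betaSubst v + betaSubst v * betaSubst w + betaSubst w * betaSubst u)
      + 8 * (betaQuot u (-v) + betaQuot v (-w) + betaQuot w (-u)) + 1 = 0 := by
  have h := betaSubst_triple hu hv hw hu0 hv0 hw0 huvw
  have q1 := sub_mul_betaQuot hu (v := -v) (by simp [hv])
  have q2 := sub_mul_betaQuot hv (v := -w) (by simp [hw])
  have q3 := sub_mul_betaQuot hw (v := -u) (by simp [hu])
  rw [betaSubst_neg hv] at q1
  rw [betaSubst_neg hw] at q2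
  rw [betaSubst_neg hu] at q3
  refine (mul_eq_zero.mp (?_ : (u * v * w) * _ = 0)).resolve_left
    (mul_ne_zero (mul_ne_zero hu0 hv0) hw0)
  obtain rfl : w = -u - v := by linear_combination huvw
  generalize betaSubst (-u - v) = bw at *
  linear_combination h - 8 * (u * v) * q1 - 8 * (v * (-u - v)) * q2 - 8 * (u * (-u - v)) * q3

/-- The divided difference is symmetric; `u - v ≠ 0` only serves to allow cancellation. -/
theorem betaQuot_comm {u v : MvPowerSeries (Fin 4) ℚ} (hu : u.constantCoeff = 0)
    (hv : v.constantCoeff = 0) (huv : u - v ≠ 0) : betaQuot u v = betaQuot v u := by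
  apply mul_left_cancel₀ huv
  linear_combination sub_mul_betaQuot hu hv + sub_mul_betaQuot hv hu

theorem betaQuot_neg_neg {u v : MvPowerSeries (Fin 4) ℚ} (hu : u.constantCoeff = 0)
    (hv : v.constantCoeff = 0) (huv : u - v ≠ 0) : betaQuot (-u) (-v) = betaQuot u v := by
  have h := sub_mul_betaQuot (u := -u) (v := -v) (by simp [hu]) (by simp [hv])
  rw [betaSubst_neg hu, betaSubst_neg hv] at h
  apply mul_left_cancel₀ huv
  linear_combination -h - sub_mul_betaQuot hu hv

/-! ### The double shuffle equations of `𝔟₁` and `𝔟₂` -/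

section Bernoulli

theorem ev4_stuffleQuot_b1 {x₁ x₂ y₁ y₂ : MvPowerSeries (Fin 4) ℚ}
    (h1 : x₁.constantCoeff = 0) (h2 : x₂.constantCoeff = 0) (h3 : y₁.constantCoeff = 0)
    (h4 : y₂.constantCoeff = 0) :
    ev4 (stuffleQuot b1) x₁ x₂ y₁ y₂ = betaQuot x₁ x₂ := by
  rw [stuffleQuot, ev4_subst_triple h1 h2 h3 h4 _ (by simp) (by simp) (by simp),
    ev4_add h1 h2 h3 h4, ev4_X₁ h1 h2 h3 h4, ev4_X₂ h1 h2 h3 h4, ev4_Y₁ h1 h2 h3 h4,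
    ev4_Y₂ h1 h2 h3 h4, divDiff_b1_subst h1 h2 (by simp [h3, h4])]

theorem ev4_shuffleQuot_b1 {x₁ x₂ y₁ y₂ : MvPowerSeries (Fin 4) ℚ}
    (h1 : x₁.constantCoeff = 0) (h2 : x₂.constantCoeff = 0) (h3 : y₁.constantCoeff = 0)
    (h4 : y₂.constantCoeff = 0) :
    ev4 (shuffleQuot b1) x₁ x₂ y₁ y₂ = betaQuot y₁ y₂ := by
  rw [shuffleQuot, flipXY_b1, ev4_subst_triple h1 h2 h3 h4 _ (by simp) (by simp) (by simp),
    ev4_add h1 h2 h3 h4, ev4_X₁ h1 h2 h3 h4, ev4_X₂ h1 h2 h3 h4, ev4_Y₁ h1 h2 h3 h4,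
    ev4_Y₂ h1 h2 h3 h4, divDiff_b1_subst h3 h4 (by simp [h1, h2])]

theorem ev4_Pb {x₁ x₂ y₁ y₂ : MvPowerSeries (Fin 4) ℚ}
    (h1 : x₁.constantCoeff = 0) (h2 : x₂.constantCoeff = 0) (h3 : y₁.constantCoeff = 0)
    (h4 : y₂.constantCoeff = 0) :
    ev4 Pb x₁ x₂ y₁ y₂
      = (betaSubst x₁ + betaSubst y₁) * (betaSubst x₂ + betaSubst y₂) := by
  rw [Pb, ev4_mul h1 h2 h3 h4, ev4_ev2 h1 h2 h3 h4 _ (by simp) (by simp),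
    ev4_ev2 h1 h2 h3 h4 _ (by simp) (by simp), ev4_X₁ h1 h2 h3 h4, ev4_X₂ h1 h2 h3 h4,
    ev4_Y₁ h1 h2 h3 h4, ev4_Y₂ h1 h2 h3 h4, ev2_b1 h1 h3, ev2_b1 h2 h4]

/-- The values of `𝔟₂` in terms of `β` and its difference quotients; the factor `12` clears the
denominators. -/
theorem ev4_b2 {x₁ x₂ y₁ y₂ : MvPowerSeries (Fin 4) ℚ}
    (h1 : x₁.constantCoeff = 0) (h2 : x₂.constantCoeff = 0) (h3 : y₁.constantCoeff = 0)
    (h4 : y₂.constantCoeff = 0) :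
    12 * ev4 b2 x₁ x₂ y₁ y₂
      = 4 * ((betaSubst x₁ + betaSubst y₁) * (betaSubst x₂ + betaSubst y₂))
      + 4 * ((betaSubst (x₁ - x₂) + betaSubst y₁) * (betaSubst x₂ + betaSubst (y₁ + y₂)))
      - 5 * betaQuot y₁ (y₁ + y₂) - betaQuot (-y₂) y₁ + 3 * betaQuot y₂ (y₁ + y₂)
      - 5 * betaQuot x₁ x₂ - betaQuot (x₂ - x₁) x₂ + 3 * betaQuot (x₁ - x₂) x₁ := by
  have k12 : (x₁ - x₂).constantCoeff = 0 := by simp [h1, h2]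
  have k21 : (x₂ - x₁).constantCoeff = 0 := by simp [h1, h2]
  have ky : (y₁ + y₂).constantCoeff = 0 := by simp [h3, h4]
  have n1 : (-y₁).constantCoeff = 0 := by simp [h3]
  have n2 : (-y₂).constantCoeff = 0 := by simp [h4]
  have n3 : (-x₂).constantCoeff = 0 := by simp [h2]
  rw [b2]
  simp only [ev4_add h1 h2 h3 h4, ev4_sub h1 h2 h3 h4, ev4_smul h1 h2 h3 h4]
  rw [ev4_stuffleQuot_b1 h1 h2 h3 h4, ev4_Pb h1 h2 h3 h4]
  have s : ∀ (f : MvPowerSeries (Fin 4) ℚ) {z₁ z₂ w₁ w₂ : MvPowerSeries (Fin 4) ℚ}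
    (k1 : z₁.constantCoeff = 0) (k2 : z₂.constantCoeff = 0) (k3 : w₁.constantCoeff = 0)
    (k4 : w₂.constantCoeff = 0), _ := fun f {z₁ z₂ w₁ w₂} => ev4_ev4 h1 h2 h3 h4 f
  rw [s Pb (by simp) (by simp) (by simp) (by simp),
    s (shuffleQuot b1) (by simp) (by simp) (by simp) (by simp),
    s (shuffleQuot b1) (by simp) (by simp) (by simp) (by simp),
    s (shuffleQuot b1) (by simp) (by simp) (by simp) (by simp),
    s (stuffleQuot b1) (by simp) (by simp) (by simp) (by simp),
    s (stuffleQuot b1) (by simp) (by simp) (by simp) (by simp)]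
  simp only [ev4_add h1 h2 h3 h4, ev4_sub h1 h2 h3 h4, ev4_neg h1 h2 h3 h4, ev4_X₁ h1 h2 h3 h4,
    ev4_X₂ h1 h2 h3 h4, ev4_Y₁ h1 h2 h3 h4, ev4_Y₂ h1 h2 h3 h4]
  rw [ev4_Pb k12 h2 h3 ky, ev4_shuffleQuot_b1 k12 h2 h3 ky, ev4_shuffleQuot_b1 n3 h1 n2 h3,
    ev4_shuffleQuot_b1 k21 h1 h4 ky, ev4_stuffleQuot_b1 k21 h2 n1 ky,
    ev4_stuffleQuot_b1 k12 h1 n2 ky]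
  have hc : 12 * algebraMap ℚ (MvPowerSeries (Fin 4) ℚ) (1 / 12) = 1 := by
    rw [← map_ofNat (algebraMap ℚ (MvPowerSeries (Fin 4) ℚ)) 12, ← map_mul]
    norm_num
  have e3 : (1 / 3 : ℚ) = 4 * (1 / 12) := by norm_num
  have e4 : (1 / 4 : ℚ) = 3 * (1 / 12) := by norm_num
  have e5 : (5 / 12 : ℚ) = 5 * (1 / 12) := by norm_num
  simp only [Algebra.smul_def]
  rw [e3, e4, e5]
  simp only [map_mul, map_ofNat]
  linear_combination (4 * ((betaSubst x₁ + betaSubst y₁) * (betaSubst x₂ + betaSubst y₂))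
      + 4 * ((betaSubst (x₁ - x₂) + betaSubst y₁) * (betaSubst x₂ + betaSubst (y₁ + y₂)))
      - 5 * betaQuot y₁ (y₁ + y₂) - betaQuot (-y₂) y₁ + 3 * betaQuot y₂ (y₁ + y₂)
      - 5 * betaQuot x₁ x₂ - betaQuot (x₂ - x₁) x₂ + 3 * betaQuot (x₁ - x₂) x₁) * hc

/-- A power series with a nonzero coefficient at a variable is nonzero. -/
theorem ne_zero_of_coeff_single {R : Type} [CommRing R] {f : MvPowerSeries (Fin 4) R}
    (i : Fin 4) (h : f.coeff (Finsupp.single i 1) ≠ 0) : f ≠ 0 := by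
  rintro rfl
  exact h (by simp)

theorem coeff_single_X {R : Type} [CommRing R] (i j : Fin 4) :
    (MvPowerSeries.X j : MvPowerSeries (Fin 4) R).coeff (Finsupp.single i 1)
      = if i = j then 1 else 0 := by
  classical
  rw [MvPowerSeries.coeff_X]
  simp only [Finsupp.single_left_inj one_ne_zero]

section NonVanishing

variable {R : Type} [CommRing R] [Nontrivial R]

theorem X₁_ne_zero : (X₁ : MvPowerSeries (Fin 4) R) ≠ 0 :=
  ne_zero_of_coeff_single 0 (by simp)

theorem X₂_ne_zero : (X₂ : MvPowerSeries (Fin 4) R) ≠ 0 :=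
  ne_zero_of_coeff_single 1 (by simp)

theorem Y₁_ne_zero : (Y₁ : MvPowerSeries (Fin 4) R) ≠ 0 :=
  ne_zero_of_coeff_single 2 (by simp)

theorem Y₂_ne_zero : (Y₂ : MvPowerSeries (Fin 4) R) ≠ 0 :=
  ne_zero_of_coeff_single 3 (by simp)

theorem X₁_sub_X₂_ne_zero : (X₁ - X₂ : MvPowerSeries (Fin 4) R) ≠ 0 :=
  ne_zero_of_coeff_single 0 (by simp [coeff_single_X])

theorem X₁_add_X₂_ne_zero : (X₁ + X₂ : MvPowerSeries (Fin 4) R) ≠ 0 :=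
  ne_zero_of_coeff_single 0 (by simp [coeff_single_X])

theorem Y₁_sub_Y₂_ne_zero : (Y₁ - Y₂ : MvPowerSeries (Fin 4) R) ≠ 0 :=
  ne_zero_of_coeff_single 2 (by simp [coeff_single_X])

theorem Y₁_add_Y₂_ne_zero : (Y₁ + Y₂ : MvPowerSeries (Fin 4) R) ≠ 0 :=
  ne_zero_of_coeff_single 2 (by simp [coeff_single_X])

end NonVanishing

theorem fortyEight_mul_cancel {f g : MvPowerSeries (Fin 4) ℚ} (h : 48 * f = 48 * g) : f = g := by
  refine mul_left_cancel₀ (fun h0 => ?_) h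
  have := congrArg MvPowerSeries.constantCoeff h0
  rw [map_ofNat, map_zero] at this
  norm_num at this

/-- The stuffle equation for `𝔟₁` and `𝔟₂`, from the addition theorem for `X₁, -X₂, X₂ - X₁` and for
`Y₁, Y₂, -Y₁ - Y₂`. -/
theorem b2_stuffle : Pb = b2 + ev4 b2 X₂ X₁ Y₂ Y₁ + stuffleQuot b1 := by
  have hb := ev4_b2 (x₁ := X₁) (x₂ := X₂) (y₁ := Y₁) (y₂ := Y₂) (by simp) (by simp) (by simp)
    (by simp)
  have hb' := ev4_b2 (x₁ := X₂) (x₂ := X₁) (y₁ := Y₂) (y₂ := Y₁) (by simp) (by simp) (by simp)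
    (by simp)
  have hP := ev4_Pb (x₁ := X₁) (x₂ := X₂) (y₁ := Y₁) (y₂ := Y₂) (by simp) (by simp) (by simp)
    (by simp)
  have hR := ev4_stuffleQuot_b1 (x₁ := X₁) (x₂ := X₂) (y₁ := Y₁) (y₂ := Y₂) (by simp) (by simp)
    (by simp) (by simp)
  rw [ev4_self] at hb hP hR
  have tX := betaQuot_triple (u := X₁) (v := -X₂) (w := -(X₁ - X₂)) (by simp) (by simp) (by simp)
    X₁_ne_zero (neg_ne_zero.2 X₂_ne_zero) (neg_ne_zero.2 X₁_sub_X₂_ne_zero) (by ring)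
  have tY := betaQuot_triple (u := Y₁) (v := Y₂) (w := -(Y₁ + Y₂)) (by simp) (by simp) (by simp)
    Y₁_ne_zero Y₂_ne_zero (neg_ne_zero.2 Y₁_add_Y₂_ne_zero) (by ring)
  -- All difference quotients are brought to the six that occur in the two addition theorems.
  have q1 : betaQuot X₂ X₁ = betaQuot X₁ X₂ :=
    (betaQuot_comm (by simp) (by simp) (X₁_sub_X₂_ne_zero (R := ℚ))).symm
  have q2 : betaQuot (-X₂) (X₁ - X₂) = betaQuot (X₂ - X₁) X₂ := by
    rw [← betaQuot_neg_neg (u := X₂ - X₁) (by simp) (by simp)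
      (by simpa using X₁_ne_zero (R := ℚ)), neg_sub, betaQuot_comm (by simp) (by simp)
      (fun h => X₁_ne_zero (R := ℚ) (by linear_combination -h))]
  have q3 : betaQuot (-(X₁ - X₂)) (-X₁) = betaQuot (X₁ - X₂) X₁ :=
    betaQuot_neg_neg (by simp) (by simp) (by simpa using X₂_ne_zero (R := ℚ))
  have q4 : betaQuot (-Y₂) Y₁ = betaQuot Y₁ (-Y₂) :=
    betaQuot_comm (by simp) (by simp) (fun h => Y₁_add_Y₂_ne_zero (R := ℚ) (by linear_combination -h))
  have q5 : betaQuot (-Y₁) Y₂ = betaQuot Y₁ (-Y₂) := by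
    rw [← betaQuot_neg_neg (u := Y₁) (by simp) (by simp)
      (by simpa using Y₁_add_Y₂_ne_zero (R := ℚ)), neg_neg]
  have q6 : betaQuot (-(Y₁ + Y₂)) (-Y₁) = betaQuot Y₁ (Y₁ + Y₂) := by
    rw [betaQuot_neg_neg (by simp) (by simp) (by simpa using Y₂_ne_zero (R := ℚ)),
      betaQuot_comm (by simp) (by simp) (by simpa using Y₂_ne_zero (R := ℚ))]
  have s1 : betaSubst (X₂ - X₁) = -betaSubst (X₁ - X₂) := by
    rw [← betaSubst_neg (by simp), neg_sub]
  have s2 : betaSubst (-(X₁ - X₂)) = -betaSubst (X₁ - X₂) := betaSubst_neg (by simp)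
  have s3 : betaSubst (-(Y₁ + Y₂)) = -betaSubst (Y₁ + Y₂) := betaSubst_neg (by simp)
  have s4 : betaSubst (-X₂) = -betaSubst X₂ := betaSubst_neg (by simp)
  rw [add_comm Y₂ Y₁, q1, q5, s1] at hb'
  rw [q4] at hb
  rw [neg_neg, neg_neg, q2, q3, s2, s4] at tX
  rw [neg_neg, q6, s3] at tY
  apply fortyEight_mul_cancel
  linear_combination 48 * hP - 4 * hb - 4 * hb' - 48 * hR - tX + tY

/-- The shuffle equation for `𝔟₁` and `𝔟₂`, from the addition theorem for `X₁, X₂, -X₁ - X₂` and for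
`Y₁, -Y₂, Y₂ - Y₁`. -/
theorem b2_shuffle :
    Pb = ev4 b2 (X₁ + X₂) X₂ Y₁ (Y₂ - Y₁) + ev4 b2 (X₁ + X₂) X₁ Y₂ (Y₁ - Y₂)
      + shuffleQuot b1 := by
  have hb := ev4_b2 (x₁ := X₁ + X₂) (x₂ := X₂) (y₁ := Y₁) (y₂ := Y₂ - Y₁) (by simp) (by simp)
    (by simp) (by simp)
  have hb' := ev4_b2 (x₁ := X₁ + X₂) (x₂ := X₁) (y₁ := Y₂) (y₂ := Y₁ - Y₂) (by simp) (by simp)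
    (by simp) (by simp)
  have hP := ev4_Pb (x₁ := X₁) (x₂ := X₂) (y₁ := Y₁) (y₂ := Y₂) (by simp) (by simp) (by simp)
    (by simp)
  have hR := ev4_shuffleQuot_b1 (x₁ := X₁) (x₂ := X₂) (y₁ := Y₁) (y₂ := Y₂) (by simp) (by simp)
    (by simp) (by simp)
  rw [ev4_self] at hP hR
  have tX := betaQuot_triple (u := X₁) (v := X₂) (w := -(X₁ + X₂)) (by simp) (by simp) (by simp)
    X₁_ne_zero X₂_ne_zero (neg_ne_zero.2 X₁_add_X₂_ne_zero) (by ring)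
  have tY := betaQuot_triple (u := Y₁) (v := -Y₂) (w := -(Y₁ - Y₂)) (by simp) (by simp) (by simp)
    Y₁_ne_zero (neg_ne_zero.2 Y₂_ne_zero) (neg_ne_zero.2 Y₁_sub_Y₂_ne_zero) (by ring)
  have q1 : betaQuot Y₂ Y₁ = betaQuot Y₁ Y₂ :=
    (betaQuot_comm (by simp) (by simp) (Y₁_sub_Y₂_ne_zero (R := ℚ))).symm
  have q2 : betaQuot (-Y₂) (Y₁ - Y₂) = betaQuot (Y₂ - Y₁) Y₂ := by
    rw [← betaQuot_neg_neg (u := Y₂ - Y₁) (by simp) (by simp)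
      (by simpa using Y₁_ne_zero (R := ℚ)), neg_sub, betaQuot_comm (by simp) (by simp)
      (fun h => Y₁_ne_zero (R := ℚ) (by linear_combination -h))]
  have q3 : betaQuot (-(Y₁ - Y₂)) (-Y₁) = betaQuot (Y₁ - Y₂) Y₁ :=
    betaQuot_neg_neg (by simp) (by simp) (by simpa using Y₂_ne_zero (R := ℚ))
  have q4 : betaQuot (-X₂) X₁ = betaQuot X₁ (-X₂) :=
    betaQuot_comm (by simp) (by simp)
      (fun h => X₁_add_X₂_ne_zero (R := ℚ) (by linear_combination -h))
  have q5 : betaQuot (-X₁) X₂ = betaQuot X₁ (-X₂) := by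
    rw [← betaQuot_neg_neg (u := X₁) (by simp) (by simp)
      (by simpa using X₁_add_X₂_ne_zero (R := ℚ)), neg_neg]
  have q6 : betaQuot (-(X₁ + X₂)) (-X₁) = betaQuot (X₁ + X₂) X₁ :=
    betaQuot_neg_neg (by simp) (by simp) (by simpa using X₂_ne_zero (R := ℚ))
  have q7 : betaQuot X₁ (X₁ + X₂) = betaQuot (X₁ + X₂) X₁ :=
    betaQuot_comm (by simp) (by simp) (by simpa using X₂_ne_zero (R := ℚ))
  have q8 : betaQuot X₂ (X₁ + X₂) = betaQuot (X₁ + X₂) X₂ :=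
    betaQuot_comm (by simp) (by simp) (by simpa using X₁_ne_zero (R := ℚ))
  have s1 : betaSubst (Y₂ - Y₁) = -betaSubst (Y₁ - Y₂) := by
    rw [← betaSubst_neg (by simp), neg_sub]
  have s2 : betaSubst (-(X₁ + X₂)) = -betaSubst (X₁ + X₂) := betaSubst_neg (by simp)
  have s3 : betaSubst (-(Y₁ - Y₂)) = -betaSubst (Y₁ - Y₂) := betaSubst_neg (by simp)
  have s4 : betaSubst (-Y₂) = -betaSubst Y₂ := betaSubst_neg (by simp)
  have z1 : (X₂ - (X₁ + X₂) : MvPowerSeries (Fin 4) ℚ) = -X₁ := by ring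
  have z2 : (X₁ - (X₁ + X₂) : MvPowerSeries (Fin 4) ℚ) = -X₂ := by ring
  rw [add_sub_cancel_right, add_sub_cancel, neg_sub, z1, s1, q5, q7] at hb
  rw [add_sub_cancel_left, add_sub_cancel, neg_sub, z2, q1, q4, q8] at hb'
  rw [neg_neg, q8, q6, s2] at tX
  rw [neg_neg, neg_neg, q2, q3, s3, s4] at tY
  apply fortyEight_mul_cancel
  linear_combination 48 * hP - 4 * hb - 4 * hb' - 48 * hR + tX - tY

end Bernoulli

/-! ### Coefficients in `q` of power series over `ℚ⟦q⟧` -/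

section QCoeff

variable {n : ℕ}

/-- The power series over `ℚ` obtained by taking the coefficient of `q^N` in every coefficient. -/
def qCoeff (N : ℕ) (f : MvPowerSeries (Fin n) (PowerSeries ℚ)) :
    MvPowerSeries (Fin n) ℚ :=
  fun e => PowerSeries.coeff N (f.coeff e)

theorem coeff_qCoeff (N : ℕ) (f : MvPowerSeries (Fin n) (PowerSeries ℚ)) (e : Fin n →₀ ℕ) :
    (qCoeff N f).coeff e = PowerSeries.coeff N (f.coeff e) := rfl

theorem qCoeff_ext {f g : MvPowerSeries (Fin n) (PowerSeries ℚ)}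
    (h : ∀ N, qCoeff N f = qCoeff N g) : f = g := by
  ext e N
  exact congrArg (MvPowerSeries.coeff e) (h N)

theorem qCoeff_sub (N : ℕ) (f g : MvPowerSeries (Fin n) (PowerSeries ℚ)) :
    qCoeff N (f - g) = qCoeff N f - qCoeff N g := by
  ext e
  simp [coeff_qCoeff]

theorem qCoeff_mul (N : ℕ) (f g : MvPowerSeries (Fin n) (PowerSeries ℚ)) :
    qCoeff N (f * g) = ∑ s ∈ Finset.HasAntidiagonal.antidiagonal N, qCoeff s.1 f * qCoeff s.2 g := by
  classical
  ext e
  rw [coeff_qCoeff, MvPowerSeries.coeff_mul, map_sum, map_sum]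
  simp only [PowerSeries.coeff_mul, MvPowerSeries.coeff_mul, coeff_qCoeff]
  rw [Finset.sum_comm]

/-- The inclusion of power series over `ℚ` into power series over `ℚ⟦q⟧`. -/
def constQ : MvPowerSeries (Fin n) ℚ →+* MvPowerSeries (Fin n) (PowerSeries ℚ) :=
  MvPowerSeries.map (algebraMap ℚ (PowerSeries ℚ))

theorem coeff_constQ (f : MvPowerSeries (Fin n) ℚ) (e : Fin n →₀ ℕ) :
    (constQ f).coeff e = PowerSeries.C (f.coeff e) := by
  rw [constQ, MvPowerSeries.coeff_map]
  rfl

theorem constQ_X (i : Fin n) : constQ (MvPowerSeries.X i) = MvPowerSeries.X i :=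
  MvPowerSeries.map_X _ i

theorem constantCoeff_constQ {f : MvPowerSeries (Fin n) ℚ} (hf : f.constantCoeff = 0) :
    (constQ f).constantCoeff = 0 := by
  rw [constQ, MvPowerSeries.constantCoeff_map, hf, map_zero]

theorem qCoeff_constQ_mul (N : ℕ) (c : MvPowerSeries (Fin n) ℚ)
    (f : MvPowerSeries (Fin n) (PowerSeries ℚ)) :
    qCoeff N (constQ c * f) = c * qCoeff N f := by
  classical
  ext e
  rw [coeff_qCoeff, MvPowerSeries.coeff_mul, map_sum, MvPowerSeries.coeff_mul]
  refine Finset.sum_congr rfl fun p _ => ?_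
  rw [coeff_constQ, PowerSeries.coeff_C_mul, coeff_qCoeff]

/-- Taking coefficients in `q` commutes with substituting power series over `ℚ`. -/
theorem qCoeff_subst {m : ℕ} (N : ℕ) (f : MvPowerSeries (Fin m) (PowerSeries ℚ))
    {a : Fin m → MvPowerSeries (Fin n) ℚ} (ha : ∀ i, (a i).constantCoeff = 0) :
    qCoeff N (f.subst fun i => constQ (a i)) = (qCoeff N f).subst a := by
  have hs : MvPowerSeries.HasSubst a := hasSubst_vec a ha
  have hs' : MvPowerSeries.HasSubst fun i => constQ (a i) :=
    hasSubst_vec _ fun i => constantCoeff_constQ (ha i)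
  ext e
  rw [coeff_qCoeff, MvPowerSeries.coeff_subst hs', MvPowerSeries.coeff_subst hs]
  have h1 := AddMonoidHom.map_finsum (PowerSeries.coeff N).toAddMonoidHom
    (MvPowerSeries.coeff_subst_finite hs' f e)
  refine Eq.trans h1 (finsum_congr fun d => ?_)
  have h2 : (d.prod fun s k => constQ (a s) ^ k) = constQ (d.prod fun s k => a s ^ k) := by
    simp only [Finsupp.prod, map_prod, map_pow]
  rw [h2, coeff_constQ, coeff_qCoeff]
  change PowerSeries.coeff N (f.coeff d * PowerSeries.C _) = _
  rw [PowerSeries.coeff_mul_C, smul_eq_mul]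

theorem qCoeff_ev2 (N : ℕ) (f : MvPowerSeries (Fin 2) (PowerSeries ℚ))
    {x y : MvPowerSeries (Fin 4) ℚ} (hx : x.constantCoeff = 0) (hy : y.constantCoeff = 0) :
    qCoeff N (ev2 f (constQ x) (constQ y)) = ev2 (qCoeff N f) x y := by
  rw [ev2, ev2, ← qCoeff_subst N f (a := ![x, y]) (by intro i; fin_cases i <;> simp [hx, hy])]
  congr 2
  funext i
  fin_cases i <;> rfl

theorem qCoeff_ev4 (N : ℕ) (f : MvPowerSeries (Fin 4) (PowerSeries ℚ))
    {x₁ x₂ y₁ y₂ : MvPowerSeries (Fin 4) ℚ} (h1 : x₁.constantCoeff = 0)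
    (h2 : x₂.constantCoeff = 0) (h3 : y₁.constantCoeff = 0) (h4 : y₂.constantCoeff = 0) :
    qCoeff N (ev4 f (constQ x₁) (constQ x₂) (constQ y₁) (constQ y₂))
      = ev4 (qCoeff N f) x₁ x₂ y₁ y₂ := by
  rw [ev4, ev4, ← qCoeff_subst N f (a := ![x₁, x₂, y₁, y₂])
    (by intro i; fin_cases i <;> simp [h1, h2, h3, h4])]
  congr 2
  funext i
  fin_cases i <;> rfl

end QCoeff

/-! ### The generating series `𝔤₁` and `𝔤₂` as sums of exponentials -/

section Exponentials

theorem coeff_prod_subst_X {n : ℕ} (f : Fin n → PowerSeries ℚ) (e : Fin n →₀ ℕ) :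
    (∏ i, (f i).subst (MvPowerSeries.X i : MvPowerSeries (Fin n) ℚ)).coeff e
      = ∏ i, PowerSeries.coeff (e i) (f i) := by
  classical
  rw [MvPowerSeries.coeff_prod]
  let l : Fin n →₀ (Fin n →₀ ℕ) := Finsupp.equivFunOnFinite.symm fun i => Finsupp.single i (e i)
  have hl : ∀ i, l i = Finsupp.single i (e i) := fun i => rfl
  rw [Finset.sum_eq_single l]
  · refine Finset.prod_congr rfl fun i _ => ?_
    rw [PowerSeries.coeff_subst_single, hl, if_pos (by simp)]
    simp
  · intro k hk hne
    by_contra hprod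
    apply hne
    have hsingle : ∀ i, k i = Finsupp.single i (k i i) := by
      intro i
      by_contra hi
      exact hprod (Finset.prod_eq_zero (Finset.mem_univ i)
        (by rw [PowerSeries.coeff_subst_single, if_neg hi]))
    rw [Finset.mem_finsuppAntidiag] at hk
    ext i j
    rw [hl, ← hk.1, Finsupp.finsetSum_apply]
    by_cases hij : i = j
    · subst hij
      rw [Finsupp.single_eq_same, Finset.sum_eq_single i]
      · intro m _ hm
        rw [hsingle m, Finsupp.single_eq_of_ne hm.symm]
      · simp
    · rw [hsingle i, Finsupp.single_eq_of_ne (Ne.symm hij), Finsupp.single_eq_of_ne (Ne.symm hij)]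
  · intro hmem
    exfalso
    apply hmem
    rw [Finset.mem_finsuppAntidiag]
    refine ⟨?_, Finset.subset_univ _⟩
    simp only [hl]
    exact Finsupp.univ_sum_single e

theorem expSubst_X_pow {n : ℕ} (i : Fin n) (c : ℕ) :
    expSubst (MvPowerSeries.X i : MvPowerSeries (Fin n) ℚ) ^ c
      = (PowerSeries.rescale (c : ℚ) (PowerSeries.exp ℚ)).subst
          (MvPowerSeries.X i : MvPowerSeries (Fin n) ℚ) := by
  rw [← PowerSeries.exp_pow_eq_rescale_exp, PowerSeries.subst_pow (PowerSeries.HasSubst.X i)]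
  rfl

theorem coeff_prod_expSubst_X_pow {n : ℕ} (c : Fin n → ℕ) (e : Fin n →₀ ℕ) :
    (∏ i, expSubst (MvPowerSeries.X i : MvPowerSeries (Fin n) ℚ) ^ c i).coeff e
      = ∏ i, ((c i : ℚ) ^ e i / (e i)!) := by
  simp only [expSubst_X_pow]
  rw [coeff_prod_subst_X fun i => PowerSeries.rescale (c i : ℚ) (PowerSeries.exp ℚ)]
  refine Finset.prod_congr rfl fun i _ => ?_
  rw [PowerSeries.coeff_rescale, PowerSeries.coeff_exp]
  simp [div_eq_mul_inv]

theorem subst_expSubst_X {m n : ℕ} {a : Fin m → MvPowerSeries (Fin n) ℚ}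
    (ha : MvPowerSeries.HasSubst a) (i : Fin m) :
    (expSubst (MvPowerSeries.X i : MvPowerSeries (Fin m) ℚ)).subst a = expSubst (a i) :=
  subst_subst_X _ ha i

theorem qCoeff_g1 (N : ℕ) :
    qCoeff N g1 = ∑ p ∈ N.divisorsAntidiagonal,
      expSubst (MvPowerSeries.X 0) ^ p.2 * expSubst (MvPowerSeries.X 1) ^ p.1 := by
  ext e
  have h : g1.coeff e = (1 / (e 1)! : ℚ) • gq (e 0 + 1) (e 1) := rfl
  rw [coeff_qCoeff, h, map_smul, gq, PowerSeries.coeff_mk, map_sum, Finset.smul_sum]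
  refine Finset.sum_congr rfl fun p _ => ?_
  have h2 := coeff_prod_expSubst_X_pow ![p.2, p.1] e
  simp only [Fin.prod_univ_two] at h2
  simp only [Matrix.cons_val_zero, Matrix.cons_val_one] at h2
  rw [h2, Nat.add_sub_cancel, smul_eq_mul]
  ring

theorem qCoeff_ev2_g1 (N : ℕ) {x y : MvPowerSeries (Fin 4) ℚ} (hx : x.constantCoeff = 0)
    (hy : y.constantCoeff = 0) :
    qCoeff N (ev2 g1 (constQ x) (constQ y))
      = ∑ p ∈ N.divisorsAntidiagonal, expSubst x ^ p.2 * expSubst y ^ p.1 := by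
  have ha := hasSubst_pair hx hy
  rw [qCoeff_ev2 N g1 hx hy, qCoeff_g1, ev2, ← MvPowerSeries.coe_substAlgHom ha, map_sum]
  simp only [map_mul, map_pow]
  simp only [MvPowerSeries.coe_substAlgHom ha, subst_expSubst_X ha]
  rfl

theorem qCoeff_g2 (N : ℕ) :
    qCoeff N g2 = ∑ s ∈ Finset.HasAntidiagonal.antidiagonal N,
      ∑ p ∈ s.1.divisorsAntidiagonal, ∑ r ∈ s.2.divisorsAntidiagonal,
        if r.1 < p.1 then
          expSubst (MvPowerSeries.X 0) ^ p.2 * expSubst (MvPowerSeries.X 1) ^ r.2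
            * expSubst (MvPowerSeries.X 2) ^ p.1 * expSubst (MvPowerSeries.X 3) ^ r.1
        else 0 := by
  ext e
  have h : g2.coeff e
    = (1 / ((e 2)! * (e 3)!) : ℚ) • gq2 (e 0 + 1) (e 1 + 1) (e 2) (e 3) := rfl
  rw [coeff_qCoeff, h, map_smul, gq2, PowerSeries.coeff_mk, map_sum, Finset.smul_sum]
  refine Finset.sum_congr rfl fun s _ => ?_
  rw [map_sum, Finset.smul_sum]
  refine Finset.sum_congr rfl fun p _ => ?_
  rw [map_sum, Finset.smul_sum]
  refine Finset.sum_congr rfl fun r _ => ?_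
  have h2 := coeff_prod_expSubst_X_pow ![p.2, r.2, p.1, r.1] e
  rw [Fin.prod_univ_four, Fin.prod_univ_four] at h2
  simp only [Matrix.cons_val] at h2
  split_ifs
  · rw [h2, Nat.add_sub_cancel, Nat.add_sub_cancel, smul_eq_mul]
    ring
  · simp

theorem qCoeff_ev4_g2 (N : ℕ) {x₁ x₂ y₁ y₂ : MvPowerSeries (Fin 4) ℚ}
    (h1 : x₁.constantCoeff = 0) (h2 : x₂.constantCoeff = 0) (h3 : y₁.constantCoeff = 0)
    (h4 : y₂.constantCoeff = 0) :
    qCoeff N (ev4 g2 (constQ x₁) (constQ x₂) (constQ y₁) (constQ y₂))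
      = ∑ s ∈ Finset.HasAntidiagonal.antidiagonal N,
        ∑ p ∈ s.1.divisorsAntidiagonal, ∑ r ∈ s.2.divisorsAntidiagonal,
          if r.1 < p.1 then
            expSubst x₁ ^ p.2 * expSubst x₂ ^ r.2 * expSubst y₁ ^ p.1 * expSubst y₂ ^ r.1
          else 0 := by
  have ha := hasSubst_quad h1 h2 h3 h4
  rw [qCoeff_ev4 N g2 h1 h2 h3 h4, qCoeff_g2, ev4, ← MvPowerSeries.coe_substAlgHom ha]
  simp only [map_sum, apply_ite (MvPowerSeries.substAlgHom ha), map_mul, map_pow, map_zero]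
  simp only [MvPowerSeries.coe_substAlgHom ha, subst_expSubst_X ha]
  rfl

end Exponentials

/-! ### Sums over `m₁ n₁ + m₂ n₂ = N` -/

section Quadruples

/-- The quadruples `((m₁, n₁), (m₂, n₂))` of positive integers with `m₁ n₁ + m₂ n₂ = N`. -/
def quads (N : ℕ) : Finset ((ℕ × ℕ) × (ℕ × ℕ)) :=
  (Finset.HasAntidiagonal.antidiagonal N).biUnion fun s =>
    s.1.divisorsAntidiagonal ×ˢ s.2.divisorsAntidiagonal

theorem mem_quads {N : ℕ} {q : (ℕ × ℕ) × (ℕ × ℕ)} :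
    q ∈ quads N ↔ q.1.1 * q.1.2 + q.2.1 * q.2.2 = N ∧ 0 < q.1.1 ∧ 0 < q.1.2 ∧ 0 < q.2.1
      ∧ 0 < q.2.2 := by
  simp only [quads, Finset.mem_biUnion, Finset.HasAntidiagonal.mem_antidiagonal, Finset.mem_product,
    Nat.mem_divisorsAntidiagonal]
  constructor
  · rintro ⟨s, hs, ⟨h1, h2⟩, h3, h4⟩
    rw [← h1] at h2
    rw [← h3] at h4
    have := mul_ne_zero_iff.1 h2
    have := mul_ne_zero_iff.1 h4
    refine ⟨by rw [h1, h3, hs], ?_⟩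
    omega
  · rintro ⟨h, h1, h2, h3, h4⟩
    exact ⟨(q.1.1 * q.1.2, q.2.1 * q.2.2), h, ⟨rfl, by positivity⟩, rfl, by positivity⟩

variable {M : Type*} [CommRing M]

theorem sum_quads (N : ℕ) (F : ℕ × ℕ → ℕ × ℕ → M) :
    ∑ s ∈ Finset.HasAntidiagonal.antidiagonal N,
        ∑ p ∈ s.1.divisorsAntidiagonal, ∑ r ∈ s.2.divisorsAntidiagonal, F p r
      = ∑ q ∈ quads N, F q.1 q.2 := by
  rw [quads, Finset.sum_biUnion]
  · exact Finset.sum_congr rfl fun s _ => (Finset.sum_product' _ _ _).symm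
  · intro s _ t _ hst
    rw [Function.onFun, Finset.disjoint_left]
    intro q hq hq'
    simp only [Finset.mem_product, Nat.mem_divisorsAntidiagonal] at hq hq'
    apply hst
    ext
    · rw [← hq.1.1, ← hq'.1.1]
    · rw [← hq.2.1, ← hq'.2.1]

theorem sum_quads_swap (N : ℕ) (F : ℕ × ℕ → ℕ × ℕ → M) :
    ∑ q ∈ quads N, F q.1 q.2 = ∑ q ∈ quads N, F q.2 q.1 := by
  refine Finset.sum_nbij' Prod.swap Prod.swap ?_ ?_ (fun _ _ => rfl) (fun _ _ => rfl)
    (fun _ _ => rfl) <;>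
  · intro q hq
    rw [mem_quads] at hq ⊢
    simp only [Prod.fst_swap, Prod.snd_swap]
    omega

theorem sum_quads_transpose (N : ℕ) (F : ℕ × ℕ → ℕ × ℕ → M) :
    ∑ q ∈ quads N, F q.1 q.2 = ∑ q ∈ quads N, F q.1.swap q.2.swap := by
  refine Finset.sum_nbij' (fun q => (q.1.swap, q.2.swap)) (fun q => (q.1.swap, q.2.swap)) ?_ ?_
    (fun _ _ => rfl) (fun _ _ => rfl) (fun _ _ => rfl) <;>
  · intro q hq
    rw [mem_quads] at hq ⊢
    simp only [Prod.fst_swap, Prod.snd_swap]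
    rw [mul_comm q.1.2, mul_comm q.2.2]
    omega

/-- The substitution `(m₁, n₁; m₂, n₂) ↦ (m₁ - m₂, n₁; m₂, n₁ + n₂)` turns the condition
`m₁ > m₂` into `n₁ < n₂`. -/
theorem sum_quads_shear (N : ℕ) (F : ℕ × ℕ → ℕ × ℕ → M) :
    (∑ q ∈ quads N, if q.2.1 < q.1.1 then F (q.1.1 - q.2.1, q.1.2) (q.2.1, q.1.2 + q.2.2) else 0)
      = ∑ q ∈ quads N, if q.1.2 < q.2.2 then F q.1 q.2 else 0 := by
  rw [← Finset.sum_filter, ← Finset.sum_filter]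
  refine Finset.sum_nbij' (fun q => ((q.1.1 - q.2.1, q.1.2), (q.2.1, q.1.2 + q.2.2)))
    (fun q => ((q.1.1 + q.2.1, q.1.2), (q.2.1, q.2.2 - q.1.2))) ?_ ?_ ?_ ?_ (fun _ _ => rfl)
  · intro q hq
    rw [Finset.mem_filter, mem_quads] at hq ⊢
    obtain ⟨⟨h, h1, h2, h3, h4⟩, hlt⟩ := hq
    obtain ⟨k, hk⟩ := Nat.exists_eq_add_of_lt hlt
    refine ⟨⟨?_, by simp only; omega, h2, h3, by simp only; omega⟩, by simp only; omega⟩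
    have hk' : q.1.1 - q.2.1 = k + 1 := by omega
    simp only [hk']
    rw [← h, hk]
    ring
  · intro q hq
    rw [Finset.mem_filter, mem_quads] at hq ⊢
    obtain ⟨⟨h, h1, h2, h3, h4⟩, hlt⟩ := hq
    obtain ⟨k, hk⟩ := Nat.exists_eq_add_of_lt hlt
    refine ⟨⟨?_, by simp only; omega, h2, h3, by simp only; omega⟩, by simp only; omega⟩
    have hk' : q.2.2 - q.1.2 = k + 1 := by omega
    simp only [hk']
    rw [← h, hk]
    ring
  · intro q hq
    rw [Finset.mem_filter] at hq
    have h1 : q.1.1 - q.2.1 + q.2.1 = q.1.1 := by omega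
    have h2 : q.1.2 + q.2.2 - q.1.2 = q.2.2 := by omega
    simp only [h1, h2]
  · intro q hq
    rw [Finset.mem_filter] at hq
    have h1 : q.1.1 + q.2.1 - q.2.1 = q.1.1 := by omega
    have h2 : q.1.2 + (q.2.2 - q.1.2) = q.2.2 := by omega
    simp only [h1, h2]

theorem sum_quads_trichotomy (N : ℕ) (f g : (ℕ × ℕ) × (ℕ × ℕ) → ℕ)
    (F : (ℕ × ℕ) × (ℕ × ℕ) → M) :
    ∑ q ∈ quads N, F q = (∑ q ∈ quads N, if f q < g q then F q else 0)
      + (∑ q ∈ quads N, if g q < f q then F q else 0)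
      + ∑ q ∈ quads N, if f q = g q then F q else 0 := by
  rw [← Finset.sum_add_distrib, ← Finset.sum_add_distrib]
  refine Finset.sum_congr rfl fun q _ => ?_
  rcases lt_trichotomy (f q) (g q) with h | h | h
  · simp [h, h.not_gt, h.ne]
  · simp [h]
  · simp [h, h.not_gt, h.ne']

/-- The terms with `m₁ = m₂` form finite geometric sums. -/
theorem sub_mul_sum_quads_diagonal (N : ℕ) (a b t : M) :
    (a - b) * (∑ q ∈ quads N, if q.1.1 = q.2.1 then a ^ q.1.2 * b ^ q.2.2 * t ^ q.1.1 else 0)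
      = ∑ p ∈ N.divisorsAntidiagonal, (a ^ p.2 * b - a * b ^ p.2) * t ^ p.1 := by
  have hreindex : (∑ q ∈ quads N,
      if q.1.1 = q.2.1 then a ^ q.1.2 * b ^ q.2.2 * t ^ q.1.1 else 0)
      = ∑ p ∈ N.divisorsAntidiagonal, ∑ i ∈ Finset.range (p.2 - 1),
          a ^ (i + 1) * b ^ (p.2 - 1 - i) * t ^ p.1 := by
    rw [← Finset.sum_filter, Finset.sum_sigma']
    refine Finset.sum_nbij' (fun q => ⟨(q.1.1, q.1.2 + q.2.2), q.1.2 - 1⟩)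
      (fun x => ((x.1.1, x.2 + 1), (x.1.1, x.1.2 - 1 - x.2))) ?_ ?_ ?_ ?_ ?_
    · rintro ⟨⟨m, n⟩, ⟨m', n'⟩⟩ hq
      simp only [Finset.mem_filter, mem_quads] at hq
      obtain ⟨⟨h, h1, h2, h3, h4⟩, rfl⟩ := hq
      simp only [Finset.mem_sigma, Nat.mem_divisorsAntidiagonal, Finset.mem_range]
      refine ⟨⟨by rw [← h]; ring, ?_⟩, by omega⟩
      rw [← h]
      positivity
    · rintro ⟨⟨m, n⟩, i⟩ hx
      simp only [Finset.mem_sigma, Nat.mem_divisorsAntidiagonal, Finset.mem_range] at hx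
      obtain ⟨⟨h, h0⟩, hi⟩ := hx
      simp only [Finset.mem_filter, mem_quads]
      have hm : 0 < m := by
        rcases Nat.eq_zero_or_pos m with rfl | hm
        · simp at h; omega
        · exact hm
      refine ⟨⟨?_, hm, by omega, hm, by omega⟩, trivial⟩
      rw [← h, ← mul_add]
      congr 1
      omega
    · rintro ⟨⟨m, n⟩, ⟨m', n'⟩⟩ hq
      simp only [Finset.mem_filter, mem_quads] at hq
      obtain ⟨⟨h, h1, h2, h3, h4⟩, rfl⟩ := hq
      have e1 : n - 1 + 1 = n := by omega
      have e2 : n + n' - 1 - (n - 1) = n' := by omega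
      simp only [e1, e2]
    · rintro ⟨⟨m, n⟩, i⟩ hx
      simp only [Finset.mem_sigma, Nat.mem_divisorsAntidiagonal, Finset.mem_range] at hx
      have e1 : i + 1 + (n - 1 - i) = n := by omega
      simp only [e1, Nat.add_sub_cancel]
    · rintro ⟨⟨m, n⟩, ⟨m', n'⟩⟩ hq
      simp only [Finset.mem_filter, mem_quads] at hq
      obtain ⟨⟨h, h1, h2, h3, h4⟩, rfl⟩ := hq
      have e1 : n - 1 + 1 = n := by omega
      have e2 : n + n' - 1 - (n - 1) = n' := by omega
      simp only [e1, e2]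
  rw [hreindex, Finset.mul_sum]
  refine Finset.sum_congr rfl fun p hp => ?_
  have hp2 : p.2 ≠ 0 := by
    rw [Nat.mem_divisorsAntidiagonal] at hp
    intro h0
    rw [h0, mul_zero] at hp
    exact hp.2 hp.1.symm
  obtain ⟨n, hn⟩ := Nat.exists_eq_succ_of_ne_zero hp2
  have hg := geom_sum₂_mul a b n
  rw [hn, Nat.succ_sub_one, ← Finset.sum_mul]
  have hsum : ∑ i ∈ Finset.range n, a ^ (i + 1) * b ^ (n - i)
      = a * b * ∑ i ∈ Finset.range n, a ^ i * b ^ (n - 1 - i) := by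
    rw [Finset.mul_sum]
    refine Finset.sum_congr rfl fun i hi => ?_
    rw [Finset.mem_range] at hi
    have : n - i = (n - 1 - i) + 1 := by omega
    rw [this]
    ring
  rw [hsum, Nat.succ_eq_add_one]
  linear_combination a * b * t ^ p.1 * hg

end Quadruples

/-! ### The double shuffle equations of `𝔤₁` and `𝔤₂` -/

section QSeries

/-- The diagonal terms in terms of `β`: with `D = u - v`, one has
`∑_{n₁ + n₂ = n} e^{n₁ u + n₂ v} = (e^{n u} - e^{n v}) / (e^D - 1) - e^{n v}`, and
`2 D / (e^D - 1) = 2 - D - 4 D β(D)`. -/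
theorem two_mul_sub_mul_sum_quads_diagonal (N : ℕ) {u v : MvPowerSeries (Fin 4) ℚ}
    (hu : u.constantCoeff = 0) (hv : v.constantCoeff = 0) (huv : u - v ≠ 0)
    (t : MvPowerSeries (Fin 4) ℚ) :
    2 * (u - v) * (∑ q ∈ quads N, if q.1.1 = q.2.1 then
        expSubst u ^ q.1.2 * expSubst v ^ q.2.2 * t ^ q.1.1 else 0)
      = (2 - (u - v) - 4 * ((u - v) * betaSubst (u - v)))
          * (∑ p ∈ N.divisorsAntidiagonal, expSubst u ^ p.2 * t ^ p.1
            - ∑ p ∈ N.divisorsAntidiagonal, expSubst v ^ p.2 * t ^ p.1)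
        - 2 * (u - v) * ∑ p ∈ N.divisorsAntidiagonal, expSubst v ^ p.2 * t ^ p.1 := by
  have huv0 : (u - v).constantCoeff = 0 := by simp [hu, hv]
  have hk := betaSubst_mul_expSubst_sub_one huv0
  have hne := expSubst_ne_one huv0 huv
  have he : expSubst (u - v) * expSubst v = expSubst u := by
    rw [← expSubst_add huv0 hv, sub_add_cancel]
  have hinv : expSubst v * expSubst (-v) = 1 := by
    rw [← expSubst_add hv (by simp [hv]), add_neg_cancel, expSubst_zero]
  have hv0 : expSubst v ≠ 0 := by
    intro h0
    rw [h0, zero_mul] at hinv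
    exact zero_ne_one hinv
  have hab : expSubst u - expSubst v = expSubst v * (expSubst (u - v) - 1) := by
    linear_combination -he
  have hab0 : expSubst u - expSubst v ≠ 0 := hab ▸ mul_ne_zero hv0 hne
  have hk' : (2 - (u - v) - 4 * ((u - v) * betaSubst (u - v))) * (expSubst u - expSubst v)
      = 2 * (u - v) * expSubst v := by
    rw [hab]
    linear_combination expSubst v * hk
  generalize 2 - (u - v) - 4 * ((u - v) * betaSubst (u - v)) = κ at *
  have hd := sub_mul_sum_quads_diagonal N (expSubst u) (expSubst v) t
  generalize expSubst u = a at *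
  generalize expSubst v = b at *
  have hs : ∑ p ∈ N.divisorsAntidiagonal, (a ^ p.2 * b - a * b ^ p.2) * t ^ p.1
      = b * ∑ p ∈ N.divisorsAntidiagonal, a ^ p.2 * t ^ p.1
        - a * ∑ p ∈ N.divisorsAntidiagonal, b ^ p.2 * t ^ p.1 := by
    rw [Finset.mul_sum, Finset.mul_sum, ← Finset.sum_sub_distrib]
    exact Finset.sum_congr rfl fun p _ => by ring
  rw [hs] at hd
  generalize ∑ p ∈ N.divisorsAntidiagonal, a ^ p.2 * t ^ p.1 = A at *
  generalize ∑ p ∈ N.divisorsAntidiagonal, b ^ p.2 * t ^ p.1 = B at *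
  apply mul_left_cancel₀ hab0
  linear_combination 2 * (u - v) * hd - (A - B) * hk'

theorem qCoeff_g1_mul_g1 (N : ℕ) :
    qCoeff N (ev2 g1 (constQ X₁) (constQ Y₁) * ev2 g1 (constQ X₂) (constQ Y₂))
      = ∑ q ∈ quads N, expSubst X₁ ^ q.1.2 * expSubst X₂ ^ q.2.2
          * expSubst Y₁ ^ q.1.1 * expSubst Y₂ ^ q.2.1 := by
  rw [qCoeff_mul, ← sum_quads N fun p r => expSubst X₁ ^ p.2 * expSubst X₂ ^ r.2
          * expSubst Y₁ ^ p.1 * expSubst Y₂ ^ r.1]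
  refine Finset.sum_congr rfl fun s _ => ?_
  rw [qCoeff_ev2_g1 _ (by simp) (by simp), qCoeff_ev2_g1 _ (by simp) (by simp),
    Finset.sum_mul_sum]
  exact Finset.sum_congr rfl fun p _ => Finset.sum_congr rfl fun r _ => by ring

/-- The product `𝔤₁(X₁; Y₁) 𝔤₁(X₂; Y₂)` is split according to `m₁ > m₂`, `m₁ < m₂`, `m₁ = m₂`. -/
theorem g1_mul_g1_stuffle :
    constQ (2 * (X₁ - X₂)) * (ev2 g1 (constQ X₁) (constQ Y₁) * ev2 g1 (constQ X₂) (constQ Y₂)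
        - ev4 g2 (constQ X₁) (constQ X₂) (constQ Y₁) (constQ Y₂)
        - ev4 g2 (constQ X₂) (constQ X₁) (constQ Y₂) (constQ Y₁))
      = constQ (2 - (X₁ - X₂) - 4 * ((X₁ - X₂) * betaSubst (X₁ - X₂)))
          * (ev2 g1 (constQ X₁) (constQ (Y₁ + Y₂)) - ev2 g1 (constQ X₂) (constQ (Y₁ + Y₂)))
        - constQ (2 * (X₁ - X₂)) * ev2 g1 (constQ X₂) (constQ (Y₁ + Y₂)) := by
  apply qCoeff_ext
  intro N
  rw [qCoeff_sub, qCoeff_constQ_mul, qCoeff_constQ_mul, qCoeff_constQ_mul, qCoeff_sub, qCoeff_sub,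
    qCoeff_sub, qCoeff_g1_mul_g1, qCoeff_ev4_g2 N (by simp) (by simp) (by simp) (by simp),
    qCoeff_ev4_g2 N (by simp) (by simp) (by simp) (by simp), qCoeff_ev2_g1 N (by simp) (by simp),
    qCoeff_ev2_g1 N (by simp) (by simp),
    ← two_mul_sub_mul_sum_quads_diagonal N (by simp) (by simp) X₁_sub_X₂_ne_zero,
    sum_quads N fun p r => if r.1 < p.1 then
      expSubst X₁ ^ p.2 * expSubst X₂ ^ r.2 * expSubst Y₁ ^ p.1 * expSubst Y₂ ^ r.1 else 0,
    sum_quads N fun p r => if r.1 < p.1 then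
      expSubst X₂ ^ p.2 * expSubst X₁ ^ r.2 * expSubst Y₂ ^ p.1 * expSubst Y₁ ^ r.1 else 0,
    sum_quads_swap N fun p r => if r.1 < p.1 then
      expSubst X₂ ^ p.2 * expSubst X₁ ^ r.2 * expSubst Y₂ ^ p.1 * expSubst Y₁ ^ r.1 else 0,
    sum_quads_trichotomy N (fun q => q.1.1) (fun q => q.2.1)]
  have e1 : (∑ q ∈ quads N, if q.1.1 < q.2.1 then
      expSubst (X₂ : MvPowerSeries (Fin 4) ℚ) ^ q.2.2 * expSubst X₁ ^ q.1.2
        * expSubst Y₂ ^ q.2.1 * expSubst Y₁ ^ q.1.1 else 0)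
      = ∑ q ∈ quads N, if q.1.1 < q.2.1 then expSubst X₁ ^ q.1.2 * expSubst X₂ ^ q.2.2
          * expSubst Y₁ ^ q.1.1 * expSubst Y₂ ^ q.2.1 else 0 :=
    Finset.sum_congr rfl fun q _ => by split_ifs <;> ring
  have e2 : (∑ q ∈ quads N, if q.1.1 = q.2.1 then
      expSubst (X₁ : MvPowerSeries (Fin 4) ℚ) ^ q.1.2 * expSubst X₂ ^ q.2.2
        * expSubst Y₁ ^ q.1.1 * expSubst Y₂ ^ q.2.1 else 0)
      = ∑ q ∈ quads N, if q.1.1 = q.2.1 then expSubst X₁ ^ q.1.2 * expSubst X₂ ^ q.2.2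
          * expSubst (Y₁ + Y₂) ^ q.1.1 else 0 :=
    Finset.sum_congr rfl fun q _ => by
      split_ifs with h
      · rw [expSubst_add (by simp) (by simp), mul_pow, ← h, ← mul_assoc]
      · rfl
  rw [e1, e2]
  ring

/-- The product `𝔤₁(X₁; Y₁) 𝔤₁(X₂; Y₂)` is split according to `n₁ < n₂`, `n₁ > n₂`, `n₁ = n₂`. -/
theorem g1_mul_g1_shuffle :
    constQ (2 * (Y₁ - Y₂)) * (ev2 g1 (constQ X₁) (constQ Y₁) * ev2 g1 (constQ X₂) (constQ Y₂)
        - ev4 g2 (constQ (X₁ + X₂)) (constQ X₂) (constQ Y₁) (constQ (Y₂ - Y₁))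
        - ev4 g2 (constQ (X₁ + X₂)) (constQ X₁) (constQ Y₂) (constQ (Y₁ - Y₂)))
      = constQ (2 - (Y₁ - Y₂) - 4 * ((Y₁ - Y₂) * betaSubst (Y₁ - Y₂)))
          * (ev2 g1 (constQ (X₁ + X₂)) (constQ Y₁) - ev2 g1 (constQ (X₁ + X₂)) (constQ Y₂))
        - constQ (2 * (Y₁ - Y₂)) * ev2 g1 (constQ (X₁ + X₂)) (constQ Y₂) := by
  apply qCoeff_ext
  intro N
  have hswap : ∀ y : MvPowerSeries (Fin 4) ℚ,
      ∑ p ∈ N.divisorsAntidiagonal, expSubst (X₁ + X₂) ^ p.2 * expSubst y ^ p.1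
        = ∑ p ∈ N.divisorsAntidiagonal, expSubst y ^ p.2 * expSubst (X₁ + X₂) ^ p.1 := by
    intro y
    conv_lhs => rw [← Nat.map_swap_divisorsAntidiagonal, Finset.sum_map]
    exact Finset.sum_congr rfl fun p _ => mul_comm _ _
  have hshear : ∀ x₁ x₂ y₁ y₂ : MvPowerSeries (Fin 4) ℚ, x₁.constantCoeff = 0 →
      x₂.constantCoeff = 0 → y₁.constantCoeff = 0 → y₂.constantCoeff = 0 →
      qCoeff N (ev4 g2 (constQ (x₁ + x₂)) (constQ x₂) (constQ y₁) (constQ (y₂ - y₁)))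
        = ∑ q ∈ quads N, if q.1.2 < q.2.2 then expSubst x₁ ^ q.1.2 * expSubst x₂ ^ q.2.2
          * expSubst y₁ ^ q.1.1 * expSubst y₂ ^ q.2.1 else 0 := by
    intro x₁ x₂ y₁ y₂ h1 h2 h3 h4
    rw [qCoeff_ev4_g2 N (by simp [h1, h2]) h2 h3 (by simp [h3, h4]),
      sum_quads N fun p r => if r.1 < p.1 then expSubst (x₁ + x₂) ^ p.2 * expSubst x₂ ^ r.2
        * expSubst y₁ ^ p.1 * expSubst (y₂ - y₁) ^ r.1 else 0,
      ← sum_quads_shear N fun p r => expSubst x₁ ^ p.2 * expSubst x₂ ^ r.2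
        * expSubst y₁ ^ p.1 * expSubst y₂ ^ r.1]
    refine Finset.sum_congr rfl fun q _ => ?_
    split_ifs with h
    · have hy : expSubst y₂ = expSubst (y₂ - y₁) * expSubst y₁ := by
        rw [← expSubst_add (by simp [h3, h4]) h3, sub_add_cancel]
      obtain ⟨k, hk⟩ := Nat.exists_eq_add_of_lt h
      have hk' : q.1.1 - q.2.1 = k + 1 := by omega
      rw [expSubst_add h1 h2, hy, hk', hk]
      ring
    · rfl
  have hsecond := hshear X₂ X₁ Y₂ Y₁ (by simp) (by simp) (by simp) (by simp)
  rw [add_comm (X₂ : MvPowerSeries (Fin 4) ℚ) X₁, sum_quads_swap N fun p r => if p.2 < r.2 then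
    expSubst X₂ ^ p.2 * expSubst X₁ ^ r.2 * expSubst Y₂ ^ p.1 * expSubst Y₁ ^ r.1 else 0]
    at hsecond
  rw [qCoeff_sub, qCoeff_constQ_mul, qCoeff_constQ_mul, qCoeff_constQ_mul, qCoeff_sub, qCoeff_sub,
    qCoeff_sub, qCoeff_g1_mul_g1, hshear _ _ _ _ (by simp) (by simp) (by simp) (by simp),
    hsecond, qCoeff_ev2_g1 N (by simp) (by simp),
    qCoeff_ev2_g1 N (by simp) (by simp), hswap, hswap,
    ← two_mul_sub_mul_sum_quads_diagonal N (by simp) (by simp) Y₁_sub_Y₂_ne_zero,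
    sum_quads_trichotomy N (fun q => q.1.2) (fun q => q.2.2)]
  have e1 : (∑ q ∈ quads N, if q.2.2 < q.1.2 then
      expSubst (X₂ : MvPowerSeries (Fin 4) ℚ) ^ q.2.2 * expSubst X₁ ^ q.1.2
        * expSubst Y₂ ^ q.2.1 * expSubst Y₁ ^ q.1.1 else 0)
      = ∑ q ∈ quads N, if q.2.2 < q.1.2 then expSubst X₁ ^ q.1.2 * expSubst X₂ ^ q.2.2
          * expSubst Y₁ ^ q.1.1 * expSubst Y₂ ^ q.2.1 else 0 :=
    Finset.sum_congr rfl fun q _ => by split_ifs <;> ring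
  have e2 : (∑ q ∈ quads N, if q.1.2 = q.2.2 then
      expSubst (X₁ : MvPowerSeries (Fin 4) ℚ) ^ q.1.2 * expSubst X₂ ^ q.2.2
        * expSubst Y₁ ^ q.1.1 * expSubst Y₂ ^ q.2.1 else 0)
      = ∑ q ∈ quads N, if q.1.1 = q.2.1 then expSubst Y₁ ^ q.1.2 * expSubst Y₂ ^ q.2.2
          * expSubst (X₁ + X₂) ^ q.1.1 else 0 := by
    rw [sum_quads_transpose N fun p r => if p.1 = r.1 then expSubst Y₁ ^ p.2 * expSubst Y₂ ^ r.2
          * expSubst (X₁ + X₂) ^ p.1 else 0]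
    refine Finset.sum_congr rfl fun q _ => ?_
    simp only [Prod.fst_swap, Prod.snd_swap]
    split_ifs with h
    · rw [expSubst_add (by simp) (by simp), mul_pow, ← h]
      ring
    · rfl
  rw [e1, e2]
  ring

end QSeries

/-! ### The double shuffle equations of `𝔈₁` and `𝔈₂` -/

section Eisenstein

theorem ev2_b1q {x y : MvPowerSeries (Fin 4) ℚ} (hx : x.constantCoeff = 0)
    (hy : y.constantCoeff = 0) :
    ev2 b1q (constQ x) (constQ y) = constQ (betaSubst x + betaSubst y) := by
  rw [← ev2_b1 hx hy, ev2, ev2, constQ, MvPowerSeries.map_subst (hasSubst_pair hx hy), b1q]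
  congr 1
  funext i
  fin_cases i <;> rfl

theorem ev4_b2q {x₁ x₂ y₁ y₂ : MvPowerSeries (Fin 4) ℚ}
    (h1 : x₁.constantCoeff = 0) (h2 : x₂.constantCoeff = 0) (h3 : y₁.constantCoeff = 0)
    (h4 : y₂.constantCoeff = 0) :
    ev4 b2q (constQ x₁) (constQ x₂) (constQ y₁) (constQ y₂) = constQ (ev4 b2 x₁ x₂ y₁ y₂) := by
  rw [ev4, ev4, constQ, MvPowerSeries.map_subst (hasSubst_quad h1 h2 h3 h4), b2q]
  congr 1
  funext i
  fin_cases i <;> rfl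

theorem ev2_E1 {x y : MvPowerSeries (Fin 4) ℚ} (hx : x.constantCoeff = 0)
    (hy : y.constantCoeff = 0) :
    ev2 E1 (constQ x) (constQ y)
      = constQ (betaSubst x + betaSubst y) + ev2 g1 (constQ x) (constQ y) := by
  rw [E1, ev2_add (constantCoeff_constQ hx) (constantCoeff_constQ hy), ev2_b1q hx hy]

/-- The values of `𝔈₂` at power series over `ℚ`; the factor `2` clears the denominator. -/
theorem ev4_E2 {x₁ x₂ y₁ y₂ : MvPowerSeries (Fin 4) ℚ}
    (h1 : x₁.constantCoeff = 0) (h2 : x₂.constantCoeff = 0) (h3 : y₁.constantCoeff = 0)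
    (h4 : y₂.constantCoeff = 0) :
    2 * ev4 E2 (constQ x₁) (constQ x₂) (constQ y₁) (constQ y₂)
      = 2 * constQ (ev4 b2 x₁ x₂ y₁ y₂)
      - 2 * (constQ (betaSubst (x₁ - x₂) + betaSubst y₂)
          * ev2 g1 (constQ x₁) (constQ (y₁ + y₂)))
      - ev2 g1 (constQ x₁) (constQ (y₁ + y₂))
      + 2 * (constQ (betaSubst x₂ + betaSubst y₂) * ev2 g1 (constQ x₁) (constQ y₁))
      + 2 * (constQ (betaSubst (x₁ - x₂) + betaSubst y₁)
          * ev2 g1 (constQ x₂) (constQ (y₁ + y₂)))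
      + 2 * ev4 g2 (constQ x₁) (constQ x₂) (constQ y₁) (constQ y₂) := by
  have k1 := constantCoeff_constQ h1
  have k2 := constantCoeff_constQ h2
  have k3 := constantCoeff_constQ h3
  have k4 := constantCoeff_constQ h4
  rw [E2]
  simp only [ev4_add k1 k2 k3 k4, ev4_sub k1 k2 k3 k4, ev4_mul k1 k2 k3 k4, ev4_smul k1 k2 k3 k4]
  rw [ev4_ev2 k1 k2 k3 k4 _ (by simp) (by simp), ev4_ev2 k1 k2 k3 k4 _ (by simp) (by simp),
    ev4_ev2 k1 k2 k3 k4 _ (by simp) (by simp), ev4_ev2 k1 k2 k3 k4 _ (by simp) (by simp),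
    ev4_ev2 k1 k2 k3 k4 _ (by simp) (by simp), ev4_ev2 k1 k2 k3 k4 _ (by simp) (by simp)]
  simp only [ev4_add k1 k2 k3 k4, ev4_sub k1 k2 k3 k4, ev4_X₁ k1 k2 k3 k4, ev4_X₂ k1 k2 k3 k4,
    ev4_Y₁ k1 k2 k3 k4, ev4_Y₂ k1 k2 k3 k4]
  rw [ev4_b2q h1 h2 h3 h4, ← map_add constQ y₁ y₂, ← map_sub constQ x₁ x₂,
    ev2_b1q (by simp [h1, h2]) h4, ev2_b1q h2 h4, ev2_b1q (by simp [h1, h2]) h3]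
  have hc : 2 * algebraMap ℚ (MvPowerSeries (Fin 4) (PowerSeries ℚ)) (1 / 2) = 1 := by
    rw [← map_ofNat (algebraMap ℚ (MvPowerSeries (Fin 4) (PowerSeries ℚ))) 2, ← map_mul]
    norm_num
  rw [Algebra.smul_def]
  linear_combination (-ev2 g1 (constQ x₁) (constQ (y₁ + y₂))) * hc

theorem two_mul_ne_zero {f : MvPowerSeries (Fin 4) (PowerSeries ℚ)} (hf : f ≠ 0) :
    2 * f ≠ 0 := by
  refine mul_ne_zero (fun h0 => ?_) hf
  have := congrArg (fun f => PowerSeries.constantCoeff (MvPowerSeries.constantCoeff f)) h0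
  simp only [map_ofNat, map_zero] at this
  norm_num at this

theorem PE_eq : PE = (constQ (betaSubst X₁ + betaSubst Y₁) + ev2 g1 (constQ X₁) (constQ Y₁))
    * (constQ (betaSubst X₂ + betaSubst Y₂) + ev2 g1 (constQ X₂) (constQ Y₂)) := by
  rw [PE, ← ev2_E1 (by simp) (by simp), ← ev2_E1 (by simp) (by simp)]
  simp only [constQ_X]

theorem PE_stuffle : PE = E2 + ev4 E2 X₂ X₁ Y₂ Y₁ + stuffleQuot E1 := by
  have hE := ev4_E2 (x₁ := X₁) (x₂ := X₂) (y₁ := Y₁) (y₂ := Y₂) (by simp) (by simp) (by simp)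
    (by simp)
  have hE' := ev4_E2 (x₁ := X₂) (x₂ := X₁) (y₁ := Y₂) (y₂ := Y₁) (by simp) (by simp) (by simp)
    (by simp)
  have hR := sub_mul_stuffleQuot E1
  have hRb := congrArg constQ (sub_mul_stuffleQuot b1)
  have hb := congrArg constQ b2_stuffle
  have hg := g1_mul_g1_stuffle
  have hP : Pb = _ := (ev4_self Pb).symm.trans
    (ev4_Pb (by simp) (by simp) (by simp) (by simp))
  have hX₁ : (X₁ : MvPowerSeries (Fin 4) (PowerSeries ℚ)) = constQ X₁ := (constQ_X 0).symm
  have hX₂ : (X₂ : MvPowerSeries (Fin 4) (PowerSeries ℚ)) = constQ X₂ := (constQ_X 1).symm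
  have hY₁ : (Y₁ : MvPowerSeries (Fin 4) (PowerSeries ℚ)) = constQ Y₁ := (constQ_X 2).symm
  have hY₂ : (Y₂ : MvPowerSeries (Fin 4) (PowerSeries ℚ)) = constQ Y₂ := (constQ_X 3).symm
  have s1 : betaSubst (X₂ - X₁ : MvPowerSeries (Fin 4) ℚ) = -betaSubst (X₁ - X₂) := by
    rw [← betaSubst_neg (by simp), neg_sub]
  have hE0 : ev4 E2 (constQ X₁) (constQ X₂) (constQ Y₁) (constQ Y₂) = E2 := by
    rw [← hX₁, ← hX₂, ← hY₁, ← hY₂, ev4_self]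
  rw [hE0, ev4_self] at hE
  rw [hX₁, hX₂, hY₁, hY₂, ← map_add constQ Y₁ Y₂, ev2_E1 (by simp) (by simp),
    ev2_E1 (by simp) (by simp), ← map_sub] at hR
  rw [ev2_b1 (by simp) (by simp), ev2_b1 (by simp) (by simp)] at hRb
  rw [add_comm Y₂ Y₁, s1] at hE'
  rw [hP] at hb
  have h0 : (constQ (X₁ - X₂) : MvPowerSeries (Fin 4) (PowerSeries ℚ)) ≠ 0 := by
    rw [map_sub, ← hX₁, ← hX₂]
    exact X₁_sub_X₂_ne_zero
  -- In the products with `𝔟₁` all values of `β` cancel except `2 β(X₁ - X₂)`, which is matched by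
  -- the diagonal terms in `hg`.
  apply mul_left_cancel₀ (two_mul_ne_zero h0)
  rw [PE_eq, hX₁, hX₂, hY₁, hY₂]
  simp only [map_add, map_sub, map_neg, map_mul, map_ofNat] at *
  linear_combination hg - (constQ X₁ - constQ X₂) * hE - (constQ X₁ - constQ X₂) * hE'
    - 2 * hR + 2 * hRb + 2 * (constQ X₁ - constQ X₂) * hb

theorem PE_shuffle : PE = ev4 E2 (X₁ + X₂) X₂ Y₁ (Y₂ - Y₁) + ev4 E2 (X₁ + X₂) X₁ Y₂ (Y₁ - Y₂)
    + shuffleQuot E1 := by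
  have hE := ev4_E2 (x₁ := X₁ + X₂) (x₂ := X₂) (y₁ := Y₁) (y₂ := Y₂ - Y₁) (by simp) (by simp)
    (by simp) (by simp)
  have hE' := ev4_E2 (x₁ := X₁ + X₂) (x₂ := X₁) (y₁ := Y₂) (y₂ := Y₁ - Y₂) (by simp) (by simp)
    (by simp) (by simp)
  have hR := sub_mul_shuffleQuot E1
  have hRb := congrArg constQ (sub_mul_shuffleQuot b1)
  have hb := congrArg constQ b2_shuffle
  have hg := g1_mul_g1_shuffle
  have hP : Pb = _ := (ev4_self Pb).symm.trans
    (ev4_Pb (by simp) (by simp) (by simp) (by simp))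
  have hX₁ : (X₁ : MvPowerSeries (Fin 4) (PowerSeries ℚ)) = constQ X₁ := (constQ_X 0).symm
  have hX₂ : (X₂ : MvPowerSeries (Fin 4) (PowerSeries ℚ)) = constQ X₂ := (constQ_X 1).symm
  have hY₁ : (Y₁ : MvPowerSeries (Fin 4) (PowerSeries ℚ)) = constQ Y₁ := (constQ_X 2).symm
  have hY₂ : (Y₂ : MvPowerSeries (Fin 4) (PowerSeries ℚ)) = constQ Y₂ := (constQ_X 3).symm
  have s1 : betaSubst (Y₂ - Y₁ : MvPowerSeries (Fin 4) ℚ) = -betaSubst (Y₁ - Y₂) := by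
    rw [← betaSubst_neg (by simp), neg_sub]
  rw [hX₁, hX₂, hY₁, hY₂, ← map_add constQ X₁ X₂, ev2_E1 (by simp) (by simp),
    ev2_E1 (by simp) (by simp), ← map_sub] at hR
  rw [ev2_b1 (by simp) (by simp), ev2_b1 (by simp) (by simp)] at hRb
  rw [add_sub_cancel_right, add_sub_cancel, s1] at hE
  rw [add_sub_cancel_left, add_sub_cancel] at hE'
  rw [hP] at hb
  have h0 : (constQ (Y₁ - Y₂) : MvPowerSeries (Fin 4) (PowerSeries ℚ)) ≠ 0 := by
    rw [map_sub, ← hY₁, ← hY₂]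
    exact Y₁_sub_Y₂_ne_zero
  apply mul_left_cancel₀ (two_mul_ne_zero h0)
  rw [PE_eq, hX₁, hX₂, hY₁, hY₂]
  simp only [map_add, map_sub, map_neg, map_mul, map_ofNat] at *
  linear_combination hg - (constQ Y₁ - constQ Y₂) * hE - (constQ Y₁ - constQ Y₂) * hE'
    - 2 * hR + 2 * hRb + 2 * (constQ Y₁ - constQ Y₂) * hb

end Eisenstein

/-! ### Coefficients of substituted power series -/

section Coefficients

variable {R : Type} [CommRing R]

theorem expo4_apply (e : Fin 4 →₀ ℕ) : expo4 (e 0) (e 1) (e 2) (e 3) = e := by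
  ext k
  fin_cases k <;> rfl

theorem expo4_inj {a b c d a' b' c' d' : ℕ} :
    expo4 a b c d = expo4 a' b' c' d' ↔ a = a' ∧ b = b' ∧ c = c' ∧ d = d' := by
  constructor
  · intro h
    exact ⟨DFunLike.congr_fun h 0, DFunLike.congr_fun h 1, DFunLike.congr_fun h 2,
      DFunLike.congr_fun h 3⟩
  · rintro ⟨rfl, rfl, rfl, rfl⟩
    rfl

theorem coeff_X_pow_mul_four (a b c d a' b' c' d' : ℕ) :
    ((X₁ ^ a' * X₂ ^ b' * Y₁ ^ c' * Y₂ ^ d' : MvPowerSeries (Fin 4) R)).coeff (expo4 a b c d)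
      = if a = a' ∧ b = b' ∧ c = c' ∧ d = d' then 1 else 0 := by
  classical
  have h : (X₁ ^ a' * X₂ ^ b' * Y₁ ^ c' * Y₂ ^ d' : MvPowerSeries (Fin 4) R)
      = MvPowerSeries.monomial (expo4 a' b' c' d') 1 := by
    rw [MvPowerSeries.monomial_one_eq, Finsupp.prod_fintype _ _ (by simp), Fin.prod_univ_four]
    rfl
  rw [h, MvPowerSeries.coeff_monomial]
  simp only [expo4_inj]

/-- A coefficient of `f.subst a` as a finite sum over any set of exponents that contains all
monomials of `f` contributing to it. -/
theorem coeff_subst_eq_sum {m : ℕ} {a : Fin m → MvPowerSeries (Fin 4) R}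
    (ha : MvPowerSeries.HasSubst a) (f : MvPowerSeries (Fin m) R) (e : Fin 4 →₀ ℕ)
    (S : Finset (Fin m →₀ ℕ)) (hS : ∀ k ∉ S, (∏ i, a i ^ k i).coeff e = 0) :
    (f.subst a).coeff e = ∑ k ∈ S, f.coeff k * (∏ i, a i ^ k i).coeff e := by
  rw [MvPowerSeries.coeff_subst ha, finsum_eq_sum_of_support_subset (s := S)]
  · refine Finset.sum_congr rfl fun k _ => ?_
    rw [Finsupp.prod_fintype _ _ (by simp), smul_eq_mul]
  · intro k hk
    by_contra hkS
    apply hk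
    simp only
    rw [Finsupp.prod_fintype _ _ (by simp), hS k hkS, smul_zero]

theorem coeff_ev4_swap (f : MvPowerSeries (Fin 4) R) (a b c d : ℕ) :
    (ev4 f X₂ X₁ Y₂ Y₁).coeff (expo4 a b c d) = f.coeff (expo4 b a d c) := by
  have hprod : ∀ k : Fin 4 →₀ ℕ,
      (∏ i, (![X₂, X₁, Y₂, Y₁] : Fin 4 → MvPowerSeries (Fin 4) R) i ^ k i).coeff (expo4 a b c d)
        = if k = expo4 b a d c then 1 else 0 := by
    intro k
    have h : (∏ i, (![X₂, X₁, Y₂, Y₁] : Fin 4 → MvPowerSeries (Fin 4) R) i ^ k i)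
        = X₁ ^ k 1 * X₂ ^ k 0 * Y₁ ^ k 3 * Y₂ ^ k 2 := by
      rw [Fin.prod_univ_four]
      simp only [Matrix.cons_val]
      ring
    rw [h, coeff_X_pow_mul_four]
    congr 1
    conv_rhs => rw [← expo4_apply k, expo4_inj]
    apply propext
    constructor <;> (rintro ⟨h1, h2, h3, h4⟩; simp [h1, h2, h3, h4])
  rw [ev4, coeff_subst_eq_sum (hasSubst_quad (by simp) (by simp) (by simp) (by simp)) f _
    {expo4 b a d c}]
  · rw [Finset.sum_singleton, hprod, if_pos rfl, mul_one]
  · intro k hk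
    rw [hprod, if_neg (by simpa using hk)]

theorem coeff_shear_monomial (a b c d i j k l : ℕ) :
    ((X₁ + X₂) ^ i * X₂ ^ j * Y₁ ^ k * (Y₂ - Y₁) ^ l : MvPowerSeries (Fin 4) R).coeff
        (expo4 a b c d)
      = if i + j = a + b ∧ k + l = c + d then
          (i.choose a : R) * (l.choose d : R) * (-1) ^ (l - d) else 0 := by
  have h : ((X₁ + X₂) ^ i * X₂ ^ j * Y₁ ^ k * (Y₂ - Y₁) ^ l : MvPowerSeries (Fin 4) R)
      = ∑ m ∈ Finset.range (i + 1), ∑ n ∈ Finset.range (l + 1),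
          MvPowerSeries.C ((i.choose m : R) * (l.choose n : R) * (-1) ^ (l - n))
            * (X₁ ^ m * X₂ ^ (i - m + j) * Y₁ ^ (k + (l - n)) * Y₂ ^ n) := by
    rw [add_pow, sub_eq_add_neg, add_pow]
    simp only [Finset.sum_mul, Finset.mul_sum]
    rw [Finset.sum_comm]
    refine Finset.sum_congr rfl fun m _ => Finset.sum_congr rfl fun n _ => ?_
    simp only [map_mul, map_pow, map_neg, map_one, map_natCast]
    rw [neg_pow Y₁]
    ring
  rw [h, map_sum]
  simp only [map_sum, MvPowerSeries.coeff_C_mul, coeff_X_pow_mul_four]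
  rw [Finset.sum_eq_single a, Finset.sum_eq_single d]
  · by_cases h : i + j = a + b ∧ k + l = c + d
    · rw [if_pos h]
      by_cases ha : a ≤ i
      · by_cases hd : d ≤ l
        · rw [if_pos (by omega), mul_one]
        · simp [Nat.choose_eq_zero_of_lt (not_le.1 hd)]
      · simp [Nat.choose_eq_zero_of_lt (not_le.1 ha)]
    · rw [if_neg h]
      by_cases ha : a ≤ i
      · by_cases hd : d ≤ l
        · rw [if_neg (by omega), mul_zero]
        · simp [Nat.choose_eq_zero_of_lt (not_le.1 hd)]
      · simp [Nat.choose_eq_zero_of_lt (not_le.1 ha)]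
  · intro n _ hn
    rw [if_neg (fun h => hn h.2.2.2.symm), mul_zero]
  · intro hd
    rw [Nat.choose_eq_zero_of_lt (n := l) (by simpa using hd)]
    simp
  · intro m _ hm
    exact Finset.sum_eq_zero fun n _ => by rw [if_neg (fun h => hm h.1.symm), mul_zero]
  · intro ha
    rw [Nat.choose_eq_zero_of_lt (n := i) (by simpa using ha)]
    simp

theorem coeff_ev4_shear (f : MvPowerSeries (Fin 4) R) (a b c d : ℕ) :
    (ev4 f (X₁ + X₂) X₂ Y₁ (Y₂ - Y₁)).coeff (expo4 a b c d)
      = ∑ p ∈ Finset.HasAntidiagonal.antidiagonal (a + b),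
          ∑ e ∈ Finset.HasAntidiagonal.antidiagonal (c + d),
            f.coeff (expo4 p.1 p.2 e.1 e.2)
              * ((p.1.choose a : R) * (e.2.choose d : R) * (-1) ^ (e.2 - d)) := by
  classical
  have hprod : ∀ k : Fin 4 →₀ ℕ,
      (∏ i, (![X₁ + X₂, X₂, Y₁, Y₂ - Y₁] : Fin 4 → MvPowerSeries (Fin 4) R) i ^ k i).coeff
        (expo4 a b c d) = if k 0 + k 1 = a + b ∧ k 2 + k 3 = c + d then
          ((k 0).choose a : R) * ((k 3).choose d : R) * (-1) ^ (k 3 - d) else 0 := by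
    intro k
    rw [← coeff_shear_monomial, Fin.prod_univ_four]
    rfl
  rw [ev4, coeff_subst_eq_sum (hasSubst_quad (by simp) (by simp) (by simp) (by simp)) f _
    ((Finset.HasAntidiagonal.antidiagonal (a + b)
      ×ˢ Finset.HasAntidiagonal.antidiagonal (c + d)).image
        fun x => expo4 x.1.1 x.1.2 x.2.1 x.2.2), Finset.sum_image, Finset.sum_product]
  · refine Finset.sum_congr rfl fun p hp => Finset.sum_congr rfl fun e he => ?_
    rw [Finset.HasAntidiagonal.mem_antidiagonal] at hp he
    rw [hprod]
    congr 1
    exact if_pos ⟨hp, he⟩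
  · rintro ⟨⟨_, _⟩, ⟨_, _⟩⟩ _ ⟨⟨_, _⟩, ⟨_, _⟩⟩ _ h
    obtain ⟨h1, h2, h3, h4⟩ := expo4_inj.1 h
    simp only at h1 h2 h3 h4
    rw [h1, h2, h3, h4]
  · intro k hk
    rw [hprod, if_neg]
    rintro ⟨h1, h2⟩
    apply hk
    rw [Finset.mem_image]
    exact ⟨((k 0, k 1), (k 2, k 3)), by simp [h1, h2], expo4_apply k⟩

theorem coeff_mul_add_pow (x y : MvPowerSeries (Fin 4) R) (u : MvPowerSeries (Fin 4) R) (n : ℕ)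
    (e : Fin 4 →₀ ℕ) : (u * (x + y) ^ n).coeff e
      = ∑ m ∈ Finset.range (n + 1), (n.choose m : R) * (u * x ^ m * y ^ (n - m)).coeff e := by
  rw [add_pow, Finset.mul_sum, map_sum]
  refine Finset.sum_congr rfl fun m _ => ?_
  rw [← MvPowerSeries.coeff_C_mul, map_natCast]
  congr 1
  ring

theorem coeff_stuffleQuot (f : MvPowerSeries (Fin 2) R) (a b c d : ℕ) :
    (stuffleQuot f).coeff (expo4 a b c d)
      = ((c + d).choose c : R) * f.coeff (expo2 (a + b + 1) (c + d)) := by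
  have hprod : ∀ k : Fin 3 →₀ ℕ,
      (∏ i, (![X₁, X₂, Y₁ + Y₂] : Fin 3 → MvPowerSeries (Fin 4) R) i ^ k i).coeff (expo4 a b c d)
        = if k = Finsupp.equivFunOnFinite.symm ![a, b, c + d] then ((c + d).choose c : R)
          else 0 := by
    intro k
    have hk : k = Finsupp.equivFunOnFinite.symm ![a, b, c + d]
        ↔ a = k 0 ∧ b = k 1 ∧ k 2 = c + d := by
      constructor
      · rintro rfl
        exact ⟨rfl, rfl, rfl⟩
      · rintro ⟨h1, h2, h3⟩
        ext i
        fin_cases i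
        exacts [h1.symm, h2.symm, h3]
    rw [Fin.prod_univ_three]
    simp only [Matrix.cons_val]
    rw [coeff_mul_add_pow]
    simp only [coeff_X_pow_mul_four]
    simp only [hk]
    rw [Finset.sum_eq_single c]
    · by_cases h : a = k 0 ∧ b = k 1 ∧ k 2 = c + d
      · rw [if_pos h, if_pos (by omega), mul_one, h.2.2]
      · rw [if_neg h]
        by_cases hc : c ≤ k 2
        · rw [if_neg (by omega), mul_zero]
        · rw [Nat.choose_eq_zero_of_lt (not_le.1 hc), Nat.cast_zero, zero_mul]
    · intro m _ hm
      rw [if_neg (fun h => hm h.2.2.1.symm), mul_zero]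
    · intro hc
      rw [Nat.choose_eq_zero_of_lt (n := k 2) (by simpa using hc)]
      simp
  rw [stuffleQuot, coeff_subst_eq_sum (hasSubst_triple (by simp) (by simp) (by simp)) _ _
    {Finsupp.equivFunOnFinite.symm ![a, b, c + d]}]
  · rw [Finset.sum_singleton, hprod, if_pos rfl, mul_comm]
    rfl
  · intro k hk
    rw [hprod, if_neg (by simpa using hk)]

theorem coeff_shuffleQuot (f : MvPowerSeries (Fin 2) R) (a b c d : ℕ) :
    (shuffleQuot f).coeff (expo4 a b c d)
      = ((a + b).choose a : R) * f.coeff (expo2 (a + b) (c + d + 1)) := by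
  have hprod : ∀ k : Fin 3 →₀ ℕ,
      (∏ i, (![Y₁, Y₂, X₁ + X₂] : Fin 3 → MvPowerSeries (Fin 4) R) i ^ k i).coeff (expo4 a b c d)
        = if k = Finsupp.equivFunOnFinite.symm ![c, d, a + b] then ((a + b).choose a : R)
          else 0 := by
    intro k
    have hk : k = Finsupp.equivFunOnFinite.symm ![c, d, a + b]
        ↔ c = k 0 ∧ d = k 1 ∧ k 2 = a + b := by
      constructor
      · rintro rfl
        exact ⟨rfl, rfl, rfl⟩
      · rintro ⟨h1, h2, h3⟩
        ext i
        fin_cases i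
        exacts [h1.symm, h2.symm, h3]
    rw [Fin.prod_univ_three]
    simp only [Matrix.cons_val]
    rw [coeff_mul_add_pow]
    have hcomm : ∀ m n : ℕ, (Y₁ ^ k 0 * Y₂ ^ k 1 * X₁ ^ m * X₂ ^ n : MvPowerSeries (Fin 4) R)
        = X₁ ^ m * X₂ ^ n * Y₁ ^ k 0 * Y₂ ^ k 1 := fun m n => by ring
    simp only [hcomm, coeff_X_pow_mul_four, hk]
    rw [Finset.sum_eq_single a]
    · by_cases h : c = k 0 ∧ d = k 1 ∧ k 2 = a + b
      · rw [if_pos h, if_pos (by omega), mul_one, h.2.2]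
      · rw [if_neg h]
        by_cases hc : a ≤ k 2
        · rw [if_neg (by omega), mul_zero]
        · rw [Nat.choose_eq_zero_of_lt (not_le.1 hc), Nat.cast_zero, zero_mul]
    · intro m _ hm
      rw [if_neg (fun h => hm h.1.symm), mul_zero]
    · intro hc
      rw [Nat.choose_eq_zero_of_lt (n := k 2) (by simpa using hc)]
      simp
  rw [shuffleQuot, coeff_subst_eq_sum (hasSubst_triple (by simp) (by simp) (by simp)) _ _
    {Finsupp.equivFunOnFinite.symm ![c, d, a + b]}]
  · rw [Finset.sum_singleton, hprod, if_pos rfl, mul_comm]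
    rfl
  · intro k hk
    rw [hprod, if_neg (by simpa using hk)]

end Coefficients

/-! ### The Eisenstein realization -/

section Realization

/-- The image of a formal symbol under the Eisenstein realization. -/
def symbValue : Symb → PowerSeries ℚ
  | .G1 k d => (d ! : ℚ) • E1.coeff (expo2 (k - 1) d)
  | .G2 k₁ k₂ d₁ d₂ => (d₁ ! * d₂ ! : ℚ) • E2.coeff (expo4 (k₁ - 1) (k₂ - 1) d₁ d₂)
  | .P k₁ k₂ d₁ d₂ => (d₁ ! * d₂ ! : ℚ) • PE.coeff (expo4 (k₁ - 1) (k₂ - 1) d₁ d₂)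

/-- The linear extension of `symbValue` to the free vector space on the symbols of weight `K`. -/
def freeRealization (K : ℕ) : Free K →ₗ[ℚ] PowerSeries ℚ :=
  Finsupp.linearCombination ℚ fun s => symbValue s.1

theorem freeRealization_gen {K : ℕ} {s : Symb} (hs : s.IsGen K) :
    freeRealization K (gen K s) = symbValue s := by
  rw [gen, dif_pos hs, freeRealization, Finsupp.linearCombination_single, one_smul]

theorem natCast_mul_eq_smul (n : ℕ) (f : PowerSeries ℚ) :
    (n : PowerSeries ℚ) * f = (n : ℚ) • f := by
  rw [Algebra.smul_def, map_natCast]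

theorem symbValue_P_stuffle {k₁ k₂ : ℕ} (d₁ d₂ : ℕ) (h1 : 1 ≤ k₁) (h2 : 1 ≤ k₂) :
    symbValue (.P k₁ k₂ d₁ d₂) = symbValue (.G2 k₁ k₂ d₁ d₂) + symbValue (.G2 k₂ k₁ d₂ d₁)
      + symbValue (.G1 (k₁ + k₂) (d₁ + d₂)) := by
  have h := congrArg (MvPowerSeries.coeff (expo4 (k₁ - 1) (k₂ - 1) d₁ d₂)) PE_stuffle
  rw [map_add, map_add, coeff_ev4_swap, coeff_stuffleQuot] at h
  have hk : k₁ - 1 + (k₂ - 1) + 1 = k₁ + k₂ - 1 := by omega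
  rw [hk] at h
  simp only [symbValue]
  rw [h, smul_add, smul_add, mul_comm (d₂ ! : ℚ)]
  congr 1
  rw [natCast_mul_eq_smul, smul_smul]
  congr 1
  have := Nat.add_choose_mul_factorial_mul_factorial d₂ d₁
  rw [add_comm d₂ d₁] at this
  rw [← this]
  push_cast
  ring

/-- The passage from the coefficients of `Y₁^d₁ Y₂^d₂ / (d₁! d₂!)` to those in `shuffleCoeff`. Both
sides vanish if `e₂ < d₂`, where the exponents are truncated. -/
theorem factorial_mul_choose {d₁ d₂ e₁ e₂ : ℕ} (h : e₁ + e₂ = d₁ + d₂) :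
    (d₁ ! * d₂ ! : ℚ) * ((e₂.choose d₂ : ℚ) * (-1) ^ (e₂ - d₂))
      = ((d₁.choose e₁ : ℚ) * (-1) ^ (d₁ - e₁)) * (e₁ ! * e₂ !) := by
  rcases le_or_gt d₂ e₂ with hd | hd
  · obtain ⟨m, rfl⟩ := Nat.exists_eq_add_of_le hd
    obtain rfl : d₁ = e₁ + m := by omega
    have e1 : d₂ + m - d₂ = m := by omega
    have e2 : e₁ + m - e₁ = m := by omega
    rw [e1, e2, Nat.cast_add_choose, Nat.cast_add_choose]
    have : (d₂ ! : ℚ) ≠ 0 := by positivity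
    have : (e₁ ! : ℚ) ≠ 0 := by positivity
    have : (m ! : ℚ) ≠ 0 := by positivity
    field_simp
  · rw [Nat.choose_eq_zero_of_lt hd, Nat.choose_eq_zero_of_lt (show d₁ < e₁ by omega)]
    simp

theorem smul_coeff_ev4_shear (a b d₁ d₂ : ℕ) :
    (d₁ ! * d₂ ! : ℚ) • (ev4 E2 (X₁ + X₂) X₂ Y₁ (Y₂ - Y₁)).coeff (expo4 a b d₁ d₂)
      = ∑ p ∈ Finset.HasAntidiagonal.antidiagonal (a + b),
          ∑ e ∈ Finset.HasAntidiagonal.antidiagonal (d₁ + d₂),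
            ((p.1.choose a : ℚ) * (d₁.choose e.1 : ℚ) * (-1) ^ (d₁ - e.1)) •
              symbValue (.G2 (p.1 + 1) (p.2 + 1) e.1 e.2) := by
  rw [coeff_ev4_shear, Finset.smul_sum]
  refine Finset.sum_congr rfl fun p _ => ?_
  rw [Finset.smul_sum]
  refine Finset.sum_congr rfl fun e he => ?_
  rw [Finset.HasAntidiagonal.mem_antidiagonal] at he
  simp only [symbValue, Nat.add_sub_cancel]
  have hc : ((p.1.choose a : PowerSeries ℚ) * (e.2.choose d₂ : PowerSeries ℚ) * (-1) ^ (e.2 - d₂))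
      = algebraMap ℚ (PowerSeries ℚ)
          ((p.1.choose a : ℚ) * (e.2.choose d₂ : ℚ) * (-1) ^ (e.2 - d₂)) := by
    simp only [map_mul, map_natCast, map_pow, map_neg, map_one]
  rw [hc, mul_comm (MvPowerSeries.coeff _ E2), ← Algebra.smul_def, smul_smul, smul_smul]
  congr 1
  linear_combination (p.1.choose a : ℚ) * factorial_mul_choose he

/-- The second value of `𝔈₂` in the shuffle equation is the first one with the indices `1` and `2`
interchanged, which accounts for the two terms of `shuffleCoeff`. -/
theorem symbValue_P_shuffle {k₁ k₂ : ℕ} (d₁ d₂ : ℕ) (h1 : 1 ≤ k₁) (h2 : 1 ≤ k₂) :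
    symbValue (.P k₁ k₂ d₁ d₂)
      = (∑ l ∈ (Finset.HasAntidiagonal.antidiagonal (k₁ + k₂)).filter
          (fun l => 1 ≤ l.1 ∧ 1 ≤ l.2),
          ∑ e ∈ Finset.HasAntidiagonal.antidiagonal (d₁ + d₂),
            shuffleCoeff k₁ k₂ d₁ d₂ l.1 e.1 • symbValue (.G2 l.1 l.2 e.1 e.2))
        + ((d₁ ! * d₂ ! : ℚ) / (d₁ + d₂ + 1)! * ((k₁ + k₂ - 2).choose (k₁ - 1) : ℚ)) •
          symbValue (.G1 (k₁ + k₂ - 1) (d₁ + d₂ + 1)) := by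
  obtain ⟨a, rfl⟩ := Nat.exists_eq_add_of_le' h1
  obtain ⟨b, rfl⟩ := Nat.exists_eq_add_of_le' h2
  have hswap : ev4 E2 (X₁ + X₂) X₁ Y₂ (Y₁ - Y₂)
      = ev4 (ev4 E2 (X₁ + X₂) X₂ Y₁ (Y₂ - Y₁)) X₂ X₁ Y₂ Y₁ := by
    have z1 : (X₂ : MvPowerSeries (Fin 4) (PowerSeries ℚ)).constantCoeff = 0 := by simp
    have z2 : (X₁ : MvPowerSeries (Fin 4) (PowerSeries ℚ)).constantCoeff = 0 := by simp
    have z3 : (Y₂ : MvPowerSeries (Fin 4) (PowerSeries ℚ)).constantCoeff = 0 := by simp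
    have z4 : (Y₁ : MvPowerSeries (Fin 4) (PowerSeries ℚ)).constantCoeff = 0 := by simp
    rw [ev4_ev4 z1 z2 z3 z4 _ (by simp) (by simp) (by simp) (by simp), ev4_add z1 z2 z3 z4,
      ev4_sub z1 z2 z3 z4, ev4_X₁ z1 z2 z3 z4, ev4_X₂ z1 z2 z3 z4, ev4_Y₁ z1 z2 z3 z4,
      ev4_Y₂ z1 z2 z3 z4, add_comm X₂]
  have h := congrArg (fun f => (d₁ ! * d₂ ! : ℚ) • MvPowerSeries.coeff (expo4 a b d₁ d₂) f)
    PE_shuffle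
  simp only [map_add, smul_add] at h
  rw [hswap, coeff_ev4_swap, smul_coeff_ev4_shear, mul_comm (d₁ ! : ℚ), smul_coeff_ev4_shear,
    mul_comm (d₂ ! : ℚ), add_comm b a, add_comm d₂ d₁, coeff_shuffleQuot,
    ← Finset.sum_add_distrib] at h
  refine (show symbValue (.P (a + 1) (b + 1) d₁ d₂) = _ from h).trans ?_
  congr 1
  · refine Finset.sum_nbij' (fun p => (p.1 + 1, p.2 + 1)) (fun l => (l.1 - 1, l.2 - 1))
      ?_ ?_ ?_ ?_ ?_
    · intro p hp
      rw [Finset.HasAntidiagonal.mem_antidiagonal] at hp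
      rw [Finset.mem_filter, Finset.HasAntidiagonal.mem_antidiagonal]
      simp only
      omega
    · intro l hl
      rw [Finset.mem_filter, Finset.HasAntidiagonal.mem_antidiagonal] at hl
      rw [Finset.HasAntidiagonal.mem_antidiagonal]
      simp only
      omega
    · intro p _
      simp
    · intro l hl
      rw [Finset.mem_filter] at hl
      have e1 : l.1 - 1 + 1 = l.1 := by omega
      have e2 : l.2 - 1 + 1 = l.2 := by omega
      simp only [e1, e2]
    · intro p _
      rw [← Finset.sum_add_distrib]
      refine Finset.sum_congr rfl fun e _ => ?_
      rw [← add_smul]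
      rfl
  · have e1 : a + 1 + (b + 1) - 2 = a + b := by omega
    have e2 : a + 1 + (b + 1) - 1 - 1 = a + b := by omega
    simp only [symbValue, e1, e2, Nat.add_sub_cancel]
    rw [natCast_mul_eq_smul, smul_smul, smul_smul]
    congr 1
    have : ((d₁ + d₂ + 1)! : ℚ) ≠ 0 := by positivity
    field_simp

theorem relations_le_ker (K : ℕ) : relations K ≤ LinearMap.ker (freeRealization K) := by
  rw [relations, Submodule.span_le]
  rintro x ⟨k₁, k₂, d₁, d₂, h1, h2, hK, hx⟩
  have hP : Symb.IsGen K (.P k₁ k₂ d₁ d₂) := ⟨h1, h2, hK⟩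
  rw [SetLike.mem_coe, LinearMap.mem_ker]
  rcases hx with rfl | rfl
  · have hG : Symb.IsGen K (.G2 k₁ k₂ d₁ d₂) := ⟨h1, h2, hK⟩
    have hG' : Symb.IsGen K (.G2 k₂ k₁ d₂ d₁) := ⟨h2, h1, by omega⟩
    have hG1 : Symb.IsGen K (.G1 (k₁ + k₂) (d₁ + d₂)) := ⟨by omega, by omega⟩
    rw [stuffleSide, map_sub, map_add, map_add, freeRealization_gen hP, freeRealization_gen hG,
      freeRealization_gen hG', freeRealization_gen hG1, symbValue_P_stuffle d₁ d₂ h1 h2, sub_self]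
  · have hG1 : Symb.IsGen K (.G1 (k₁ + k₂ - 1) (d₁ + d₂ + 1)) := ⟨by omega, by omega⟩
    rw [shuffleSide, map_sub, map_add, map_smul, freeRealization_gen hP, freeRealization_gen hG1,
      symbValue_P_shuffle d₁ d₂ h1 h2, sub_eq_zero, map_sum]
    congr 1
    refine Finset.sum_congr rfl fun l hl => ?_
    rw [map_sum]
    refine Finset.sum_congr rfl fun e he => ?_
    rw [Finset.mem_filter, Finset.HasAntidiagonal.mem_antidiagonal] at hl
    rw [Finset.HasAntidiagonal.mem_antidiagonal] at he
    rw [map_smul, freeRealization_gen (s := .G2 l.1 l.2 e.1 e.2) ⟨hl.2.1, hl.2.2, by omega⟩]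

/-- The Eisenstein realization of the formal double Eisenstein space of weight `K`. -/
def realization (K : ℕ) : DE K →ₗ[ℚ] PowerSeries ℚ :=
  (relations K).liftQ (freeRealization K) (relations_le_ker K)

theorem realization_of {K : ℕ} {s : Symb} (hs : s.IsGen K) :
    realization K (DE.of K s) = symbValue s := by
  rw [realization, DE.of, Submodule.mkQ_apply, Submodule.liftQ_apply, freeRealization_gen hs]

theorem eq_realization {K : ℕ} {ρ : DE K →ₗ[ℚ] PowerSeries ℚ}
    (h : ∀ s : Symb, s.IsGen K → ρ (DE.of K s) = symbValue s) : ρ = realization K := by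
  apply Submodule.linearMap_qext
  apply Finsupp.lhom_ext'
  rintro ⟨s, hs⟩
  apply LinearMap.ext_ring
  have hg : gen K s = Finsupp.single ⟨s, hs⟩ 1 := dif_pos hs
  have := (h s hs).trans (realization_of hs).symm
  rw [DE.of, hg] at this
  exact this

/-! ### The Eisenstein series in the image -/

theorem coeff_E1 (a b : ℕ) : E1.coeff (expo2 a b)
    = PowerSeries.C (b1.coeff (expo2 a b)) + (1 / b ! : ℚ) • gq (a + 1) b := by
  rw [E1, map_add, b1q, MvPowerSeries.coeff_map]
  rfl

theorem coeff_iterate_qDeriv (d N : ℕ) (f : PowerSeries ℚ) :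
    PowerSeries.coeff N (qDeriv^[d] f) = (N : ℚ) ^ d * PowerSeries.coeff N f := by
  induction d generalizing f with
  | zero => simp
  | succ d ih =>
    rw [Function.iterate_succ_apply, ih, qDeriv, pow_succ, mul_assoc]
    congr 1
    rcases N with _ | N
    · simp
    · rw [PowerSeries.coeff_succ_X_mul, PowerSeries.coeff_derivative]
      push_cast
      ring

theorem coeff_Gtilde (k N : ℕ) (hk : 1 ≤ k) : PowerSeries.coeff N (Gtilde k)
    = (if N = 0 ∧ k ≠ 1 then -bernoulli k / (2 * k !) else 0)
      + ∑ p ∈ N.divisorsAntidiagonal, (p.2 : ℚ) ^ (k - 1) / (k - 1)! := by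
  rw [Gtilde]
  split_ifs with h1 h2 h2
  · exact absurd h1 h2.2
  · subst h1
    simp [gq]
  · obtain ⟨rfl, -⟩ := h2
    simp
  · have hN : N ≠ 0 := fun h => h2 ⟨h, h1⟩
    rw [map_add, PowerSeries.coeff_C, if_neg hN, PowerSeries.coeff_mk,
      ArithmeticFunction.sigma_apply, Nat.sum_divisorsAntidiagonal'
        (f := fun _ j => (j : ℚ) ^ (k - 1) / (k - 1)!)]
    push_cast
    rw [Finset.mul_sum]
    congr 1
    exact Finset.sum_congr rfl fun j _ => by ring

theorem symbValue_G1 {k d : ℕ} (hdk : d < k) : symbValue (.G1 k d)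
    = ((k - d - 1)! / (k - 1)! : ℚ) • qDeriv^[d] (Gtilde (k - d)) := by
  have hd : (d ! : ℚ) ≠ 0 := by positivity
  have hk1 : k - 1 + 1 = k := by omega
  ext N
  simp only [symbValue]
  rw [coeff_E1, hk1, map_smul, map_smul, map_add, map_smul, coeff_iterate_qDeriv,
    coeff_Gtilde _ _ (by omega), coeff_b1, coeff_beta, coeff_beta, gq, PowerSeries.coeff_mk,
    PowerSeries.coeff_C]
  simp only [smul_eq_mul]
  have hsum : ∑ p ∈ N.divisorsAntidiagonal, (p.1 : ℚ) ^ d * (p.2 : ℚ) ^ (k - 1) / (k - 1)!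
      = ((k - d - 1)! / (k - 1)! : ℚ) * ((N : ℚ) ^ d
        * ∑ p ∈ N.divisorsAntidiagonal, (p.2 : ℚ) ^ (k - d - 1) / (k - d - 1)!) := by
    rw [Finset.mul_sum, Finset.mul_sum]
    refine Finset.sum_congr rfl fun p hp => ?_
    rw [Nat.mem_divisorsAntidiagonal] at hp
    have hkd : k - 1 = d + (k - d - 1) := by omega
    have f1 : ((k - d - 1)! : ℚ) ≠ 0 := by positivity
    have f2 : ((k - 1)! : ℚ) ≠ 0 := by positivity
    rw [← hp.1]
    push_cast
    field_simp
    rw [mul_pow]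
    conv_lhs => rw [hkd, pow_add]
    ring
  rw [mul_add, ← mul_assoc (d ! : ℚ), mul_one_div_cancel hd, one_mul, hsum, mul_add, mul_add]
  congr 1
  rcases Nat.eq_zero_or_pos d with rfl | hd0
  · have f2 : ((k - 1)! : ℚ) ≠ 0 := by positivity
    rcases eq_or_ne k 1 with rfl | hk
    · simp
    · have hk0 : k - 1 ≠ 0 := by omega
      by_cases hN : N = 0 <;> simp [hN, hk0, hk, hk1, f2]
  · have hk0 : k - 1 ≠ 0 := by omega
    by_cases hN : N = 0 <;> simp [hN, hk0, hd0.ne']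

theorem coeff_PE (a b : ℕ) : PE.coeff (expo4 a b 0 0)
    = E1.coeff (expo2 a 0) * E1.coeff (expo2 b 0) := by
  classical
  have h1 : ∀ e : Fin 4 →₀ ℕ, (ev2 E1 X₁ Y₁).coeff e
      = if ∀ k, k ≠ 0 → k ≠ 2 → e k = 0 then E1.coeff (expo2 (e 0) (e 2)) else 0 :=
    fun e => subst_pair_coeff E1 0 2 (by decide) e
  have h2 : ∀ e : Fin 4 →₀ ℕ, (ev2 E1 X₂ Y₂).coeff e
      = if ∀ k, k ≠ 1 → k ≠ 3 → e k = 0 then E1.coeff (expo2 (e 1) (e 3)) else 0 :=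
    fun e => subst_pair_coeff E1 1 3 (by decide) e
  rw [PE, MvPowerSeries.coeff_mul, Finset.sum_eq_single (expo4 a 0 0 0, expo4 0 b 0 0)]
  · rw [h1, h2, if_pos, if_pos]
    · rfl
    · intro k hk hk'
      fin_cases k
      exacts [rfl, absurd rfl hk, rfl, absurd rfl hk']
    · intro k hk hk'
      fin_cases k
      exacts [absurd rfl hk, rfl, absurd rfl hk', rfl]
  · rintro ⟨e, e'⟩ he hne
    rw [Finset.HasAntidiagonal.mem_antidiagonal] at he
    simp only at he
    rw [h1, h2]
    split_ifs with k1 k2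
    · exfalso
      apply hne
      have s0 : e 0 + e' 0 = a := DFunLike.congr_fun he 0
      have s1 : e 1 + e' 1 = b := DFunLike.congr_fun he 1
      have s2 : e 2 + e' 2 = 0 := DFunLike.congr_fun he 2
      have s3 : e 3 + e' 3 = 0 := DFunLike.congr_fun he 3
      have t1 : e 1 = 0 := k1 1 (by decide) (by decide)
      have t0 : e' 0 = 0 := k2 0 (by decide) (by decide)
      have u0 : e 0 = a := by omega
      have u1 : e' 1 = b := by omega
      have u2 : e 2 = 0 := by omega
      have u3 : e 3 = 0 := by omega
      have u4 : e' 2 = 0 := by omega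
      have u5 : e' 3 = 0 := by omega
      rw [← expo4_apply e, ← expo4_apply e', u0, u1, u2, u3, u4, u5, t0, t1]
    · simp
    · simp
    · simp
  · intro h
    exfalso
    apply h
    rw [Finset.HasAntidiagonal.mem_antidiagonal]
    ext k
    fin_cases k <;> simp [expo4]

theorem symbValue_P {k₁ k₂ : ℕ} (h1 : 1 ≤ k₁) (h2 : 1 ≤ k₂) :
    symbValue (.P k₁ k₂ 0 0) = Gtilde k₁ * Gtilde k₂ := by
  have h : ∀ k, 1 ≤ k → E1.coeff (expo2 (k - 1) 0) = Gtilde k := by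
    intro k hk
    have hG := symbValue_G1 (show 0 < k by omega)
    have f : ((k - 1)! : ℚ) ≠ 0 := by positivity
    simpa [symbValue, div_self f] using hG
  simp only [symbValue, coeff_PE, h k₁ h1, h k₂ h2]
  simp

end Realization

end DoubleEisenstein

end

theorem theorem3 :
    (PE = E2 + ev4 E2 X₂ X₁ Y₂ Y₁ + stuffleQuot E1 ∧
      PE = ev4 E2 (X₁ + X₂) X₂ Y₁ (Y₂ - Y₁) + ev4 E2 (X₁ + X₂) X₁ Y₂ (Y₁ - Y₂)
        + shuffleQuot E1) ∧
    ∀ K : ℕ, 1 ≤ K → ∃! ρ : DE K →ₗ[ℚ] PowerSeries ℚ,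
      ((∀ k d : ℕ, 1 ≤ k → k + d = K →
          ρ (DE.of K (.G1 k d)) = (d ! : ℚ) • E1.coeff (expo2 (k - 1) d)) ∧
        (∀ k₁ k₂ d₁ d₂ : ℕ, 1 ≤ k₁ → 1 ≤ k₂ → k₁ + k₂ + d₁ + d₂ = K →
          ρ (DE.of K (.G2 k₁ k₂ d₁ d₂))
            = (d₁ ! * d₂ ! : ℚ) • E2.coeff (expo4 (k₁ - 1) (k₂ - 1) d₁ d₂)) ∧
        (∀ k₁ k₂ d₁ d₂ : ℕ, 1 ≤ k₁ → 1 ≤ k₂ → k₁ + k₂ + d₁ + d₂ = K →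
          ρ (DE.of K (.P k₁ k₂ d₁ d₂))
            = (d₁ ! * d₂ ! : ℚ) • PE.coeff (expo4 (k₁ - 1) (k₂ - 1) d₁ d₂))) ∧
      (∀ k d : ℕ, d < k → k + d = K →
          ρ (DE.of K (.G1 k d))
            = ((k - d - 1)! / (k - 1)! : ℚ) • qDeriv^[d] (Gtilde (k - d))) ∧
      (∀ k₁ k₂ : ℕ, 1 ≤ k₁ → 1 ≤ k₂ → k₁ + k₂ = K →
          ρ (DE.of K (.P k₁ k₂ 0 0)) = Gtilde k₁ * Gtilde k₂) := by
  refine ⟨⟨PE_stuffle, PE_shuffle⟩, fun K _ => ⟨realization K, ⟨⟨?_, ?_, ?_⟩, ?_, ?_⟩, ?_⟩⟩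
  · intro k d hk hK
    exact realization_of ⟨hk, hK⟩
  · intro k₁ k₂ d₁ d₂ h1 h2 hK
    exact realization_of ⟨h1, h2, hK⟩
  · intro k₁ k₂ d₁ d₂ h1 h2 hK
    exact realization_of ⟨h1, h2, hK⟩
  · intro k d hdk hK
    rw [realization_of (s := .G1 k d) ⟨by omega, hK⟩, symbValue_G1 hdk]
  · intro k₁ k₂ h1 h2 hK
    rw [realization_of (s := .P k₁ k₂ 0 0) ⟨h1, h2, by omega⟩, symbValue_P h1 h2]
  · rintro ρ ⟨⟨hG1, hG2, hP⟩, -⟩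
    apply eq_realization
    rintro (⟨k, d⟩ | ⟨k₁, k₂, d₁, d₂⟩ | ⟨k₁, k₂, d₁, d₂⟩) hs
    · exact hG1 k d hs.1 hs.2
    · exact hG2 k₁ k₂ d₁ d₂ hs.1 hs.2.1 hs.2.2
    · exact hP k₁ k₂ d₁ d₂ hs.1 hs.2.1 hs.2.2
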